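/- Lemma 1. Let $v$ be a real Borel function of the distance $r\ge 0$ with $v\le 0$ and $|v(r)|\le\alpha_1e^{-\alpha_2 r}$ for some constants $\alpha_1,\alpha_2>0$. Assume that $v$ is tuned to the zero energy p-wave resonance: for the operators $h(\lambda)=-\Delta_x+\lambda v(|x|)$ on the space of odd functions in $L^2(\mathbb R^2)$, with domain the odd functions in the Sobolev space $\mathcal H^2(\mathbb R^2)$, one has $h(1)\ge 0$, and $h(1+\varepsilon)\not\ge 0$ for every $\varepsilon>0$. Consider three particles in $\mathbb R^2$ with positions $r_1,r_2,r_3$ and, after removal of the center of mass, the Jacobi coordinates $x_1=r_3-r_2$, $y_1=\frac{2}{\sqrt3}\bigl[r_1-\frac{r_2+r_3}{2}\bigr]$ on $\mathbb R^4$. A permutation $p$ of $\{1,2,3\}$ acts on $L^2(\mathbb R^4)$ by $(pf)(x_1,y_1)=f(p(x_1),p(y_1))$, where $p(x_1),p(y_1)$ are the Jacobi coordinates of $(r_{p(1)},r_{p(2)},r_{p(3)})$. Let $L^2_A(\mathbb R^4)$ be the subspace of all $\psi$ with $p\psi=\operatorname{sign}(p)\,\psi$ for all $p$. Put $v_\alpha=v(|r_\beta-r_\gamma|)$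 for $\{\alpha,\beta,\gamma\}=\{1,2,3\}$, $H_0=-\Delta_{x_1}-\Delta_{y_1}$, and let $H=H_0+v_1+v_2+v_3$ on $L^2_A(\mathbb R^4)$, with domain $L^2_A(\mathbb R^4)\cap\mathcal H^2(\mathbb R^4)$. Let $\mathcal H_A\subset L^2(\mathbb R^4)\oplus L^2(\mathbb R^4)\oplus L^2(\mathbb R^4)$ be the space of all $(\phi_1,\phi_2,\phi_3)$ with $p_{ik}\phi_\alpha=-\phi_{p_{ik}(\alpha)}$ for every transposition $p_{ik}$ of $\{1,2,3\}$ and every $\alpha\in\{1,2,3\}$. For $z>0$ let $M(z)$ be the operator on $\mathcal H_A$ with the matrix entries $$M_{\alpha\beta}(z)=|v_\alpha|^{1/2}(H_0+z^2)^{-1}|v_\beta|^{1/2},\qquad \alpha,\beta\in\{1,2,3\}.$$ Then, for every $z>0$, the number of bound states of $H$ with energy less than $-z^2$ (the number of eigenvalues of $H$ in $(-\infty,-z^2)$, counted with multiplicity) equals the number of eigenvalues of $M(z)$ larger than $1$, counted with multiplicity. -/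

import Mathlib

open MeasureTheory FourierTransform
open scoped ENNReal Laplacian SchwartzMap

namespace ThreeFermions

noncomputable section

/-! ### Operators on `L²(E)` for a finite-dimensional real inner product space `E` -/

section General

variable (E : Type*) [NormedAddCommGroup E] [InnerProductSpace ℝ E] [FiniteDimensional ℝ E]
  [MeasurableSpace E] [BorelSpace E]

/-- The complex Hilbert space `L²(E)`. -/
abbrev L2 : Type _ := Lp ℂ 2 (volume : Measure E)

variable {E}

/-- Multiplication by an essentially bounded function, as a bounded operator on `L²(E)`. -/
def mulOp (g : E → ℂ) (hg : MemLp g ∞ volume) : L2 E →L[ℂ] L2 E :=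
  (ContinuousLinearMap.mul ℂ ℂ).holderL volume ∞ 2 2 (hg.toLp g)

/-- Composition `f ↦ f ∘ T` with a linear isometry `T` of `E`, as an operator on `L²(E)`. -/
def compOp (T : E ≃ₗᵢ[ℝ] E) : L2 E →ₗᵢ[ℂ] L2 E :=
  Lp.compMeasurePreservingₗᵢ ℂ T T.measurePreserving

/-- A bounded measurable function is essentially bounded. -/
theorem memLp_top_ofReal {g : E → ℝ} (hg : Measurable g) {C : ℝ} (hC : ∀ X, |g X| ≤ C) :
    MemLp (fun X => (g X : ℂ)) ∞ (volume : Measure E) := by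
  refine memLp_top_of_bound (C := C) (by fun_prop) (.of_forall fun X => ?_)
  simpa using hC X

variable (E) in
/-- The embedding of `L²(E)` into the tempered distributions. -/
def toDistrib : L2 E →ₗ[ℂ] 𝓢'(E, ℂ) :=
  (Lp.toTemperedDistributionCLM ℂ (volume : Measure E) 2).toLinearMap

theorem toDistrib_injective : Function.Injective (toDistrib E) :=
  LinearMap.ker_eq_bot.mp Lp.ker_toTemperedDistributionCLM_eq_bot

variable (E) in
/-- The Sobolev space `H²(E)`, as a subspace of `L²(E)`. -/
def sobolev2 : Submodule ℂ (L2 E) where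
  carrier := {ψ | TemperedDistribution.MemSobolev 2 2 (toDistrib E ψ)}
  add_mem' {f g} hf hg := by
    simp only [Set.mem_ofPred_eq, map_add] at hf hg ⊢
    exact hf.add hg
  zero_mem' := by simp
  smul_mem' c f hf := by
    simp only [Set.mem_ofPred_eq, map_smul] at hf ⊢
    exact hf.smul c

variable (E) in
/-- The distributional operator `-Δ` on `H²(E)`. -/
def distribNegLaplacian : sobolev2 E →ₗ[ℂ] 𝓢'(E, ℂ) :=
  -((LineDeriv.laplacianCLM ℂ E 𝓢'(E, ℂ)).toLinearMap ∘ₗ toDistrib E ∘ₗ (sobolev2 E).subtype)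

theorem distribNegLaplacian_apply (ψ : sobolev2 E) :
    distribNegLaplacian E ψ = -Δ (toDistrib E ψ) := by
  simp [distribNegLaplacian]

/-- The distributional Laplacian of a function in `H²(E)` is a function in `L²(E)`. -/
theorem distribNegLaplacian_mem_range (ψ : sobolev2 E) :
    distribNegLaplacian E ψ ∈ LinearMap.range (toDistrib E) := by
  have h : TemperedDistribution.MemSobolev 2 2 (toDistrib E ψ) := ψ.2
  have h2 := h.laplacian
  rw [sub_self, TemperedDistribution.memSobolev_zero_iff] at h2
  obtain ⟨f, hf⟩ := h2
  refine ⟨-f, ?_⟩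
  rw [distribNegLaplacian_apply, hf, map_neg]
  rfl

variable (E) in
/-- The operator `-Δ` in `L²(E)` with domain `H²(E)`: the value at `ψ` is the element of `L²(E)`
that represents the distribution `-Δψ`. -/
def negLaplacian : L2 E →ₗ.[ℂ] L2 E where
  domain := sobolev2 E
  toFun := (LinearEquiv.ofInjective (toDistrib E) toDistrib_injective).symm.toLinearMap ∘ₗ
    (distribNegLaplacian E).codRestrict _ distribNegLaplacian_mem_range

/-- The Schrödinger operator `-Δ + W` with a bounded operator `W`, with domain `S ∩ H²(E)`, where
`S` is the subspace of `L²(E)` that describes the particle statistics. -/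
def schrodinger (W : L2 E →L[ℂ] L2 E) (S : Submodule ℂ (L2 E)) : L2 E →ₗ.[ℂ] L2 E :=
  (negLaplacian E + W.toLinearMap.toPMap ⊤).domRestrict S

theorem resolventSymbol_memLp (z : ℝ) (hz : 0 < z) :
    MemLp (fun ξ : E => ((((2 * Real.pi * ‖ξ‖) ^ 2 + z ^ 2)⁻¹ : ℝ) : ℂ)) ∞
      (volume : Measure E) := by
  refine memLp_top_ofReal (C := (z ^ 2)⁻¹) (by fun_prop) fun ξ => ?_
  rw [abs_of_nonneg (by positivity)]
  gcongr
  nlinarith [sq_nonneg (2 * Real.pi * ‖ξ‖)]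

variable (E) in
/-- The resolvent `(-Δ + z²)⁻¹` on `L²(E)`, for `z > 0`. In the normalization
`𝓕 f ξ = ∫ exp (-2πi⟨x, ξ⟩) f x` used here, `-Δ` is multiplication by `(2π‖ξ‖)²` on the
Fourier side. -/
def resolvent (z : ℝ) (hz : 0 < z) : L2 E →L[ℂ] L2 E :=
  (Lp.fourierTransformₗᵢ E ℂ).symm.toContinuousLinearEquiv.toContinuousLinearMap ∘L
    mulOp _ (resolventSymbol_memLp z hz) ∘L
    (Lp.fourierTransformₗᵢ E ℂ).toContinuousLinearEquiv.toContinuousLinearMap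

end General

/-! ### Counting eigenvalues -/

section Eigenvalues

variable {K : Type*} [NormedAddCommGroup K] [InnerProductSpace ℂ K]

/-- The space of all `ψ` in the domain of `T` with `T ψ = e ψ`. -/
def eigenspace (T : K →ₗ.[ℂ] K) (e : ℝ) : Submodule ℂ K where
  carrier := {ψ | ∃ h : ψ ∈ T.domain, T ⟨ψ, h⟩ = (e : ℂ) • ψ}
  add_mem' := by
    rintro f g ⟨hf, hf'⟩ ⟨hg, hg'⟩
    refine ⟨add_mem hf hg, ?_⟩
    rw [smul_add, ← hf', ← hg', ← LinearPMap.map_add]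
    rfl
  zero_mem' := ⟨zero_mem _, by rw [smul_zero]; exact LinearPMap.map_zero T⟩
  smul_mem' := by
    rintro c f ⟨hf, hf'⟩
    refine ⟨Submodule.smul_mem _ c hf, ?_⟩
    rw [smul_comm, ← hf', ← LinearPMap.map_smul]
    rfl

/-- The number (possibly `∞`) of eigenvalues of `T` in `I ⊆ ℝ`, counted with multiplicity: the sum
of the dimensions of the eigenspaces over all `e ∈ I`, as the supremum of its finite partial
sums. -/
def eigenvalueCount (T : K →ₗ.[ℂ] K) (I : Set ℝ) : ℕ∞ :=
  ⨆ (s : Finset ℝ) (_ : (s : Set ℝ) ⊆ I),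
    ∑ e ∈ s, Cardinal.toENat (Module.rank ℂ (eigenspace T e))

/-- `T ≥ 0` in the sense of quadratic forms: `⟨f, T f⟩ ≥ 0` for all `f` in the domain of `T`. -/
def IsNonneg (T : K →ₗ.[ℂ] K) : Prop :=
  ∀ f : T.domain, 0 ≤ (inner ℂ (f : K) (T f)).re

end Eigenvalues

/-! ### The pair interaction and the two-body problem -/

/-- A pair interaction: a Borel function `v ≤ 0` of the distance `r ≥ 0` with
`|v r| ≤ α₁ exp (-α₂ r)` for some constants `α₁, α₂ > 0`. -/
structure PairInteraction where
  toFun : ℝ → ℝ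
  measurable_toFun : Measurable toFun
  nonpos : ∀ r, 0 ≤ r → toFun r ≤ 0
  decay : ∃ α₁ > 0, ∃ α₂ > 0, ∀ r, 0 ≤ r → |toFun r| ≤ α₁ * Real.exp (-α₂ * r)

instance : CoeFun PairInteraction fun _ => ℝ → ℝ := ⟨PairInteraction.toFun⟩

theorem PairInteraction.exists_bound (v : PairInteraction) : ∃ C, ∀ r, 0 ≤ r → |v r| ≤ C := by
  obtain ⟨a, ha, b, hb, h⟩ := v.decay
  refine ⟨a, fun r hr => (h r hr).trans ?_⟩
  have : Real.exp (-b * r) ≤ 1 := Real.exp_le_one_iff.mpr (by nlinarith)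
  nlinarith

/-- The plane `ℝ²`. -/
abbrev Plane : Type := EuclideanSpace ℝ (Fin 2)

/-- The odd functions in `L²(ℝ²)`. -/
def oddSubspace : Submodule ℂ (L2 Plane) where
  carrier := {φ | compOp (LinearIsometryEquiv.neg ℝ) φ = -φ}
  add_mem' {f g} hf hg := by
    simp only [Set.mem_ofPred_eq, map_add] at hf hg ⊢
    rw [hf, hg, neg_add]
  zero_mem' := by simp
  smul_mem' c f hf := by
    simp only [Set.mem_ofPred_eq, map_smul] at hf ⊢
    rw [hf, smul_neg]

theorem PairInteraction.memLp_plane (v : PairInteraction) :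
    MemLp (fun x : Plane => ((v ‖x‖ : ℝ) : ℂ)) ∞ volume := by
  obtain ⟨C, hC⟩ := v.exists_bound
  exact memLp_top_ofReal (v.measurable_toFun.comp measurable_norm) fun x => hC _ (norm_nonneg x)

/-- The two-body Hamiltonian `h(λ) = -Δ + λ v(|x|)` on the odd functions in `L²(ℝ²)`. -/
def twoBodyHamiltonian (v : PairInteraction) (coupling : ℝ) : L2 Plane →ₗ.[ℂ] L2 Plane :=
  schrodinger ((coupling : ℂ) • mulOp _ v.memLp_plane) oddSubspace

/-- `v` is tuned to the zero energy p-wave resonance: `h(1) ≥ 0`, and `h(1 + ε) ≱ 0` for all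
`ε > 0`. -/
def PairInteraction.IsTuned (v : PairInteraction) : Prop :=
  IsNonneg (twoBodyHamiltonian v 1) ∧ ∀ ε : ℝ, 0 < ε → ¬ IsNonneg (twoBodyHamiltonian v (1 + ε))

/-! ### The three-body problem -/

/-- The configuration space `ℝ⁴` of the Jacobi coordinates `(x₁, y₁)`. The particles `1, 2, 3` are
numbered by `0, 1, 2 : Fin 3`. -/
abbrev Config : Type := WithLp 2 (Plane × Plane)

/-- The Jacobi coordinates `x₁ = r₃ - r₂` and `y₁ = (2/√3) (r₁ - (r₂ + r₃)/2)`. -/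
def jacobi : (Fin 3 → Plane) →ₗ[ℝ] Config where
  toFun r := WithLp.toLp 2
    (r 2 - r 1, (2 / Real.sqrt 3) • (r 0 - (1 / 2 : ℝ) • (r 1 + r 2)))
  map_add' r s := by
    rw [← WithLp.toLp_add]
    congr 1
    refine Prod.ext ?_ ?_
    · change r 2 + s 2 - (r 1 + s 1) = (r 2 - r 1) + (s 2 - s 1)
      module
    · change (2 / Real.sqrt 3) • (r 0 + s 0 - (1 / 2 : ℝ) • (r 1 + s 1 + (r 2 + s 2))) =
        (2 / Real.sqrt 3) • (r 0 - (1 / 2 : ℝ) • (r 1 + r 2)) +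
          (2 / Real.sqrt 3) • (s 0 - (1 / 2 : ℝ) • (s 1 + s 2))
      module
  map_smul' c r := by
    rw [RingHom.id_apply, ← WithLp.toLp_smul]
    congr 1
    refine Prod.ext ?_ ?_
    · change c • r 2 - c • r 1 = c • (r 2 - r 1)
      module
    · change (2 / Real.sqrt 3) • (c • r 0 - (1 / 2 : ℝ) • (c • r 1 + c • r 2)) =
        c • (2 / Real.sqrt 3) • (r 0 - (1 / 2 : ℝ) • (r 1 + r 2))
      module

/-- The particle positions with given Jacobi coordinates and center of mass at the origin. -/
def position : Config →ₗ[ℝ] (Fin 3 → Plane) where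
  toFun X := ![(1 / Real.sqrt 3) • X.snd,
    -((1 / 2 : ℝ) • X.fst) - (1 / (2 * Real.sqrt 3)) • X.snd,
    (1 / 2 : ℝ) • X.fst - (1 / (2 * Real.sqrt 3)) • X.snd]
  map_add' X Y := by
    ext1 i
    fin_cases i <;> simp <;> module
  map_smul' c X := by
    ext1 i
    fin_cases i <;> simp <;> module

theorem sum_position (X : Config) : ∑ i, position X i = 0 := by
  have h : (1 / Real.sqrt 3) = 2 * (1 / (2 * Real.sqrt 3)) := by field_simp
  simp only [Fin.sum_univ_three, position, LinearMap.coe_mk, AddHom.coe_mk, Matrix.cons_val]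
  rw [h]
  module

theorem jacobi_position (X : Config) : jacobi (position X) = X := by
  have h : (2 / Real.sqrt 3) * (1 / Real.sqrt 3) = 2 / 3 := by
    field_simp; norm_num
  have h' : (2 / Real.sqrt 3) * (1 / (2 * Real.sqrt 3)) = 1 / 3 := by
    field_simp; norm_num
  apply (WithLp.equiv 2 (Plane × Plane)).injective
  ext1
  · simp only [jacobi, position, LinearMap.coe_mk, AddHom.coe_mk, Matrix.cons_val,
      WithLp.equiv_apply]
    change _ = X.fst
    module
  · simp only [jacobi, position, LinearMap.coe_mk, AddHom.coe_mk, Matrix.cons_val,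
      WithLp.equiv_apply]
    change _ = X.snd
    simp only [smul_sub, smul_add, smul_neg, smul_smul, mul_left_comm _ (1 / 2 : ℝ), h, h']
    module

theorem norm_jacobi_sq (r : Fin 3 → Plane) (hr : ∑ i, r i = 0) :
    ‖jacobi r‖ ^ 2 = 2 * ∑ i, ‖r i‖ ^ 2 := by
  have h0 : r 0 = -(r 1 + r 2) := by
    rw [Fin.sum_univ_three, add_assoc] at hr
    exact eq_neg_of_add_eq_zero_left hr
  have hy : r 0 - (1 / 2 : ℝ) • (r 1 + r 2) = (-(3 / 2) : ℝ) • (r 1 + r 2) := by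
    rw [h0]; module
  have h3 : Real.sqrt 3 ^ 2 = 3 := Real.sq_sqrt (by norm_num)
  rw [WithLp.prod_norm_sq_eq_of_L2]
  simp only [jacobi, LinearMap.coe_mk, AddHom.coe_mk, WithLp.toLp_fst, WithLp.toLp_snd]
  rw [hy, Fin.sum_univ_three, h0, norm_neg, norm_smul, norm_smul, mul_pow, mul_pow,
    Real.norm_eq_abs, Real.norm_eq_abs, sq_abs, sq_abs, div_pow, h3,
    @norm_add_sq_real _ _ _ (r 1) (r 2), norm_sub_rev, @norm_sub_sq_real _ _ _ (r 1) (r 2)]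
  ring

/-- The map `(x₁, y₁) ↦ (p(x₁), p(y₁))`, the Jacobi coordinates of `(r_{p(1)}, r_{p(2)}, r_{p(3)})`
where `(x₁, y₁)` are those of `(r₁, r₂, r₃)`. It is a linear isometry of `ℝ⁴`. -/
def permIsometry (p : Equiv.Perm (Fin 3)) : Config ≃ₗᵢ[ℝ] Config :=
  LinearIsometry.toLinearIsometryEquiv
    { toLinearMap := jacobi ∘ₗ LinearMap.funLeft ℝ Plane p ∘ₗ position
      norm_map' := by
        intro X
        have h1 : ‖jacobi (position X ∘ p)‖ ^ 2 = ‖jacobi (position X)‖ ^ 2 := by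
          rw [norm_jacobi_sq _ (sum_position X), norm_jacobi_sq _ (by
            simpa using (Equiv.sum_comp p (position X)).trans (sum_position X))]
          congr 1
          exact Equiv.sum_comp p fun i => ‖position X i‖ ^ 2
        rw [jacobi_position] at h1
        exact (sq_eq_sq₀ (norm_nonneg _) (norm_nonneg _)).mp h1 }
    rfl

/-- The permutation operator `(p f)(x₁, y₁) = f(p(x₁), p(y₁))` on `L²(ℝ⁴)`. -/
def permOp (p : Equiv.Perm (Fin 3)) : L2 Config →ₗᵢ[ℂ] L2 Config :=
  compOp (permIsometry p)

/-- The antisymmetric functions `L²_A(ℝ⁴)`: `p ψ = sign(p) ψ` for all permutations `p`. -/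
def antisymmetricSubspace : Submodule ℂ (L2 Config) where
  carrier := {ψ | ∀ p : Equiv.Perm (Fin 3), permOp p ψ = ((Equiv.Perm.sign p : ℤ) : ℂ) • ψ}
  add_mem' {f g} hf hg p := by rw [map_add, hf p, hg p, smul_add]
  zero_mem' p := by simp
  smul_mem' c f hf p := by rw [map_smul, hf p, smul_comm]

/-- `v_α = v(|r_β - r_γ|)` as a function on `ℝ⁴`, where `{α, β, γ} = {1, 2, 3}`. -/
def pairPotential (v : PairInteraction) (α : Fin 3) (X : Config) : ℝ :=
  v ‖position X (α + 1) - position X (α + 2)‖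

theorem measurable_pairPotential (v : PairInteraction) (α : Fin 3) :
    Measurable (pairPotential v α) := by
  have : ContinuousSMul ℝ Config := IsBoundedSMul.continuousSMul
  have hp : Continuous position := LinearMap.continuous_of_finiteDimensional _
  have h : Continuous fun X : Config => ‖position X (α + 1) - position X (α + 2)‖ := by fun_prop
  exact v.measurable_toFun.comp h.measurable

theorem memLp_pairPotential (v : PairInteraction) (α : Fin 3) :
    MemLp (fun X => ((pairPotential v α X : ℝ) : ℂ)) ∞ volume := by
  obtain ⟨C, hC⟩ := v.exists_bound
  exact memLp_top_ofReal (measurable_pairPotential v α) fun X => hC _ (norm_nonneg _)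

theorem memLp_sqrt_pairPotential (v : PairInteraction) (α : Fin 3) :
    MemLp (fun X => ((Real.sqrt |pairPotential v α X| : ℝ) : ℂ)) ∞ volume := by
  obtain ⟨C, hC⟩ := v.exists_bound
  refine memLp_top_ofReal (C := Real.sqrt C) (measurable_pairPotential v α).abs.sqrt fun X => ?_
  rw [abs_of_nonneg (Real.sqrt_nonneg _)]
  exact Real.sqrt_le_sqrt (hC _ (norm_nonneg _))

/-- Multiplication by `v_α` on `L²(ℝ⁴)`. -/
def potentialOp (v : PairInteraction) (α : Fin 3) : L2 Config →L[ℂ] L2 Config :=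
  mulOp _ (memLp_pairPotential v α)

/-- Multiplication by `|v_α|^{1/2}` on `L²(ℝ⁴)`. -/
def sqrtPotentialOp (v : PairInteraction) (α : Fin 3) : L2 Config →L[ℂ] L2 Config :=
  mulOp _ (memLp_sqrt_pairPotential v α)

/-- The three-body Hamiltonian `H = H₀ + v₁ + v₂ + v₃`, with `H₀ = -Δ_{x₁} - Δ_{y₁}`, on the domain
`L²_A(ℝ⁴) ∩ H²(ℝ⁴)`. -/
def hamiltonian (v : PairInteraction) : L2 Config →ₗ.[ℂ] L2 Config :=
  schrodinger (∑ α, potentialOp v α) antisymmetricSubspace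

/-- The number of bound states of the three-body Hamiltonian with energy less than `-z²`. -/
def boundStateCount (v : PairInteraction) (z : ℝ) : ℕ∞ :=
  eigenvalueCount (hamiltonian v) (Set.Iio (-z ^ 2))

/-- `L²(ℝ⁴) ⊕ L²(ℝ⁴) ⊕ L²(ℝ⁴)`. -/
abbrev TripleL2 : Type := PiLp 2 fun _ : Fin 3 => L2 Config

/-- The space `𝓗_A` of all triples `(φ₁, φ₂, φ₃)` with `p_{ik} φ_α = -φ_{p_{ik}(α)}` for every
transposition `p_{ik}` and every `α`. -/
def faddeevSpace : Submodule ℂ TripleL2 where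
  carrier := {φ | ∀ i k : Fin 3, i ≠ k → ∀ α,
    permOp (Equiv.swap i k) (φ α) = -φ (Equiv.swap i k α)}
  add_mem' {f g} hf hg i k hik α := by
    rw [PiLp.add_apply, PiLp.add_apply, map_add, hf i k hik, hg i k hik, neg_add]
  zero_mem' i k _ α := by simp
  smul_mem' c f hf i k hik α := by
    rw [PiLp.smul_apply, PiLp.smul_apply, map_smul, hf i k hik, smul_neg]

/-- The entry `M_{αβ}(z) = |v_α|^{1/2} (H₀ + z²)⁻¹ |v_β|^{1/2}`. -/
def birmanSchwingerEntry (v : PairInteraction) (z : ℝ) (hz : 0 < z) (α β : Fin 3) :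
    L2 Config →L[ℂ] L2 Config :=
  sqrtPotentialOp v α ∘L resolvent Config z hz ∘L sqrtPotentialOp v β

/-- The matrix operator with the entries `M_{αβ}(z)`, on all triples:
`(M(z) φ)_α = ∑_β M_{αβ}(z) φ_β`. -/
def birmanSchwingerMatrix (v : PairInteraction) (z : ℝ) (hz : 0 < z) : TripleL2 →L[ℂ] TripleL2 :=
  (PiLp.continuousLinearEquiv 2 ℂ fun _ : Fin 3 => L2 Config).symm.toContinuousLinearMap ∘L
    ContinuousLinearMap.pi fun α =>
      ∑ β, birmanSchwingerEntry v z hz α β ∘L PiLp.proj 2 (fun _ : Fin 3 => L2 Config) β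

/-- The Birman–Schwinger operator `M(z)` on `𝓗_A`: the restriction of the matrix operator to the
domain `𝓗_A`, so that its eigenvectors are the nonzero `φ ∈ 𝓗_A` with `M(z) φ = λ φ`. -/
def birmanSchwinger (v : PairInteraction) (z : ℝ) (hz : 0 < z) : TripleL2 →ₗ.[ℂ] TripleL2 :=
  (birmanSchwingerMatrix v z hz).toLinearMap.toPMap faddeevSpace

end

end ThreeFermions

/-! Write V = ∑ |v_α| = T*T with Tψ = (|v_α|^{1/2} ψ)_α, and R = (H₀ + z²)⁻¹. Since v ≤ 0, H = H₀ -
V, and M(z) = T R T*. T maps L²_A into 𝓗_A and T* maps it back, so both counts can be compared as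
dimensions of subspaces on which a quadratic form is positive.

Birman–Schwinger: for w² > ‖V‖ the operator B = (H + w²)⁻¹ is bounded. With c = w² - z² and ψ = Bη,
the form of cB² - B at η is -⟨ψ, (H + z²)ψ⟩, so its positive eigenvalues correspond to eigenvalues
of H below -z². If M > 1 at φ, then ψ = R T*φ satisfies ⟨ψ, (H + z²)ψ⟩ = ⟨φ, Mφ⟩ - ‖Mφ‖² < 0. If ⟨ψ,
(H + z²)ψ⟩ < 0, Cauchy–Schwarz for the form of R gives M > 1 at Tψ. Both transports are linear and
preserve dimension (`IsPosOn.exists_finrank_eq_of_resolvent`).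

Passing from forms to eigenvalues requires that the spectrum of M above 1 consists of finitely many
eigenvalues (`exists_finrank_le_of_isPosOn`). The condition h(1) ≥ 0 keeps the diagonal entries
below some d < 1 on functions odd in the pair coordinate, because H₀ - |v_α| ≥ 0 there while z² > 0
leaves a margin. An off-diagonal entry couples two different pairs; it is Hilbert–Schmidt up to an
arbitrarily small error in norm, because the two pair separations are independent coordinates of ℝ⁴
and v is integrable on the plane. A Hilbert–Schmidt operator can exceed a fixed positive size on
only boundedly many orthonormal vectors.

Given finiteness, the range of the positive part of a self-adjoint operator is a maximal positive
subspace and is spanned by the relevant eigenvectors (`exists_positive_spectral_subspace`,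
`eigenvalueCount_eq_finrank`). -/

open scoped InnerProductSpace

namespace ThreeFermions

/-! ### Positive subspaces of bounded self-adjoint operators -/

section PositiveIndex

variable {K : Type*} [NormedAddCommGroup K] [InnerProductSpace ℂ K]

/-- The quadratic form of `A` is positive on `W`. -/
def IsPosOn (A : K →L[ℂ] K) (W : Submodule ℂ K) : Prop :=
  ∀ g ∈ W, g ≠ 0 → 0 < (inner ℂ g (A g)).re

theorem IsPosOn.mono {A : K →L[ℂ] K} {W W' : Submodule ℂ K} (h : IsPosOn A W) (hW : W' ≤ W) :
    IsPosOn A W' := fun g hg => h g (hW hg)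

/-- A subspace all of whose finite-dimensional subspaces have dimension at most `N` is
finite-dimensional. -/
theorem finiteDimensional_of_finrank_le {W : Submodule ℂ K} {N : ℕ}
    (h : ∀ W' ≤ W, FiniteDimensional ℂ W' → Module.finrank ℂ W' ≤ N) : FiniteDimensional ℂ W := by
  by_contra hW
  have hrank : Cardinal.aleph0 ≤ Module.rank ℂ W := by
    by_contra hlt
    exact hW (Module.rank_lt_aleph0_iff.mp (not_le.mp hlt))
  have h1 : ((N + 1 : ℕ) : Cardinal) ≤ Module.rank ℂ W :=
    (Cardinal.natCast_lt_aleph0).le.trans hrank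
  obtain ⟨s, hs, hli⟩ := exists_finset_linearIndependent_of_le_rank h1
  let f : s → K := fun i => (i : W)
  have hf : LinearIndependent ℂ f := hli.map' W.subtype W.ker_subtype
  have h2 := h (Submodule.span ℂ (Set.range f)) (by
    rw [Submodule.span_le]
    rintro _ ⟨i, rfl⟩
    exact (i : W).2) (FiniteDimensional.span_of_finite ℂ (Set.finite_range f))
  rw [finrank_span_eq_card hf, Fintype.card_coe, hs] at h2
  omega

/-- A subspace of `S` on which `A` is positive is at most as large as one whose orthogonal
complement in `S` carries a nonpositive form. -/
theorem finrank_le_of_isPosOn {A : K →L[ℂ] K} {S G W : Submodule ℂ K} [FiniteDimensional ℂ G]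
    (hG : ∀ x ∈ S, x ∈ Gᗮ → (inner ℂ x (A x)).re ≤ 0) (hWS : W ≤ S) (hW : IsPosOn A W) :
    Module.finrank ℂ W ≤ Module.finrank ℂ G := by
  -- A nonzero vector of W orthogonal to G would carry a form both positive and nonpositive, so the
  -- orthogonal projection onto G is injective on W.
  have hinj : Function.Injective (G.orthogonalProjectionOnto.toLinearMap ∘ₗ W.subtype) := by
    rw [← LinearMap.ker_eq_bot, LinearMap.ker_eq_bot']
    rintro ⟨x, hx⟩ h0
    have h1 : x ∈ Gᗮ := Submodule.orthogonalProjectionOnto_eq_zero_iff.mp h0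
    by_contra hne
    have h2 : x ≠ 0 := fun h => hne (by ext; exact h)
    exact absurd (hW x hx h2) (not_lt.mpr (hG x (hWS hx) h1))
  exact LinearMap.finrank_le_finrank_of_injective hinj

variable [CompleteSpace K]

theorem exists_isSelfAdjoint_comp_self {A : K →L[ℂ] K} (hA : 0 ≤ A) :
    ∃ C : K →L[ℂ] K, IsSelfAdjoint C ∧ A = C ∘L C :=
  ⟨CFC.sqrt A, (CFC.sqrt_nonneg A).isSelfAdjoint, (CFC.sqrt_mul_sqrt_self A).symm⟩

/-- The Cauchy–Schwarz inequality for the quadratic form of a nonnegative operator. -/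
theorem sq_re_inner_le {A : K →L[ℂ] K} (hA : 0 ≤ A) (x y : K) :
    (inner ℂ x (A y)).re ^ 2 ≤ (inner ℂ x (A x)).re * (inner ℂ y (A y)).re := by
  obtain ⟨C, hC, rfl⟩ := exists_isSelfAdjoint_comp_self hA
  have hsym := hC.isSymmetric
  have h (u w : K) : inner ℂ u ((C ∘L C) w) = inner ℂ (C u) (C w) := (hsym u (C w)).symm
  have h2 (u : K) : (inner ℂ (C u) (C u)).re = ‖C u‖ ^ 2 := by
    rw [inner_self_eq_norm_sq_to_K]; norm_cast
  rw [h, h, h, h2, h2, ← mul_pow]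
  exact sq_le_sq' (by
    have := (abs_le.mp ((Complex.abs_re_le_norm _).trans
      (norm_inner_le_norm (𝕜 := ℂ) (C x) (C y)))).1
    linarith) ((Complex.re_le_norm _).trans (norm_inner_le_norm (𝕜 := ℂ) _ _))

/-- Cauchy–Schwarz for the form of A, applied to Ax and x, bounds ‖Ax‖⁴ by a multiple of ⟨x, Ax⟩. -/
theorem apply_eq_zero_of_re_inner_eq_zero {A : K →L[ℂ] K} (hA : 0 ≤ A) {x : K}
    (hx : (inner ℂ x (A x)).re = 0) : A x = 0 := by
  have h := sq_re_inner_le hA (A x) x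
  rw [hx, mul_zero, inner_self_eq_norm_sq_to_K] at h
  have h2 : ‖A x‖ ^ 2 = 0 := by
    have : ((((‖A x‖ : ℝ) : ℂ)) ^ 2).re = ‖A x‖ ^ 2 := by norm_cast
    have h3 : (‖A x‖ ^ 2) ^ 2 ≤ 0 := by rw [← this]; exact h
    nlinarith [sq_nonneg (‖A x‖ ^ 2)]
  simpa using h2

/-- The spectral subspace of positive energy of `A`, inside an invariant subspace `S`. -/
theorem exists_positive_spectral_subspace (A : K →L[ℂ] K) (hA : IsSelfAdjoint A)
    (S : Submodule ℂ K) [S.HasOrthogonalProjection] (hS : ∀ x ∈ S, A x ∈ S) (N : ℕ)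
    (hN : ∀ W ≤ S, FiniteDimensional ℂ W → IsPosOn A W → Module.finrank ℂ W ≤ N) :
    ∃ G ≤ S, FiniteDimensional ℂ G ∧ IsPosOn A G ∧
      (∀ x ∈ S, ∀ μ : ℝ, 0 < μ → A x = (μ : ℂ) • x → x ∈ G) ∧
      (∀ x ∈ S, x ∈ Gᗮ → (inner ℂ x (A x)).re ≤ 0) ∧
      ∀ B : K →L[ℂ] K, Commute B A → (∀ x ∈ S, B x ∈ S) → ∀ x ∈ G, B x ∈ G := by
  have hpos : 0 ≤ A⁺ := CFC.posPart_nonneg A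
  have hneg : 0 ≤ A⁻ := CFC.negPart_nonneg A
  have hsub : A⁺ - A⁻ = A := CFC.posPart_sub_negPart A hA
  have hcomm (B : K →L[ℂ] K) (hB : Commute B A) : Commute B A⁺ := by
    rw [CFC.posPart_def]
    exact (hB.symm.cfcₙ_real _).symm
  -- An invariant subspace of a self-adjoint operator is reducing. Functional calculus then makes A⁺
  -- commute with the projection, so A⁺ preserves S as well.
  have hPA : Commute S.starProjection A := by
    have hsymP : (S.starProjection : K →ₗ[ℂ] K).IsSymmetric := S.starProjection_isSymmetric
    ext x
    refine ext_inner_right ℂ fun y => ?_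
    have h1 (x : K) : A (S.starProjection x) ∈ S := hS _ (S.starProjection_apply_mem x)
    have h2 (x : K) : S.starProjection (A (S.starProjection x)) = A (S.starProjection x) :=
      Submodule.starProjection_eq_self_iff.mpr (h1 x)
    have hAs := hA.isSymmetric
    change inner ℂ (S.starProjection (A x)) y = inner ℂ (A (S.starProjection x)) y
    calc inner ℂ (S.starProjection (A x)) y = inner ℂ (A x) (S.starProjection y) := hsymP _ _
      _ = inner ℂ x (A (S.starProjection y)) := hAs _ _
      _ = inner ℂ x (S.starProjection (A (S.starProjection y))) := by rw [h2]
      _ = inner ℂ (S.starProjection x) (A (S.starProjection y)) := (hsymP _ _).symm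
      _ = inner ℂ (A (S.starProjection x)) (S.starProjection y) := (hAs _ _).symm
      _ = inner ℂ (S.starProjection (A (S.starProjection x))) y := (hsymP _ _).symm
      _ = _ := by rw [h2]
  have hSpos : ∀ x ∈ S, A⁺ x ∈ S := by
    intro x hx
    have h := DFunLike.congr_fun (hcomm _ hPA) x
    change S.starProjection (A⁺ x) = A⁺ (S.starProjection x) at h
    rw [Submodule.starProjection_eq_self_iff.mpr hx] at h
    exact Submodule.starProjection_eq_self_iff.mp h
  have hAA (x : K) : A (A⁺ x) = A⁺ (A⁺ x) := by
    have h : A * A⁺ = A⁺ * A⁺ := by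
      nth_rw 1 [← hsub]
      rw [sub_mul, CFC.negPart_mul_posPart, sub_zero]
    exact DFunLike.congr_fun h x
  have hApos (x : K) : A⁺ (A x) = A⁺ (A⁺ x) := by
    have h : A⁺ * A = A⁺ * A⁺ := by
      nth_rw 2 [← hsub]
      rw [mul_sub, CFC.posPart_mul_negPart, sub_zero]
    exact DFunLike.congr_fun h x
  have hsymPos := hpos.isSelfAdjoint.isSymmetric
  have hinner (A' : K →L[ℂ] K) (h : 0 ≤ A') (x : K) : 0 ≤ (inner ℂ x (A' x)).re :=
    ((ContinuousLinearMap.nonneg_iff_isPositive A').mp h).re_inner_nonneg_right x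
  -- The subspace is G = A⁺(S). There A acts as A⁺, because A⁻A⁺ = 0. If the form vanishes at A⁺x,
  -- then A⁺A⁺x = 0, and so ‖A⁺x‖² = ⟨x, A⁺A⁺x⟩ = 0.
  have hG : IsPosOn A (S.map (A⁺ : K →L[ℂ] K).toLinearMap) := by
    rintro _ ⟨x, -, rfl⟩ hne
    change 0 < (inner ℂ (A⁺ x) (A (A⁺ x))).re
    rw [hAA]
    refine lt_of_le_of_ne (hinner _ hpos _) fun h0 => hne ?_
    have h1 := apply_eq_zero_of_re_inner_eq_zero hpos h0.symm
    have h2 : inner ℂ (A⁺ x) (A⁺ x) = (0 : ℂ) := by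
      rw [hsymPos.apply_clm, h1, inner_zero_right]
    exact inner_self_eq_zero.mp h2
  have hGS : S.map (A⁺ : K →L[ℂ] K).toLinearMap ≤ S := by
    rintro _ ⟨x, hx, rfl⟩
    exact hSpos x hx
  refine ⟨_, hGS, finiteDimensional_of_finrank_le fun W hW hfin =>
    hN W (hW.trans hGS) hfin (hG.mono hW), hG, ?_, ?_, ?_⟩
  · intro x hx μ hμ hxe
    -- From A⁻A = -(A⁻)² one gets μ⟨x, A⁻x⟩ = -‖A⁻x‖², and the two sides have opposite signs.
    have h0 : A⁻ x = 0 := by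
      have h1 : A⁻ (A x) = -(A⁻ (A⁻ x)) := by
        have h : A⁻ * A = -(A⁻ * A⁻) := by
          nth_rw 2 [← hsub]
          rw [mul_sub, CFC.negPart_mul_posPart, zero_sub]
        exact DFunLike.congr_fun h x
      rw [hxe, map_smul] at h1
      have h2 := congrArg (fun u => (inner ℂ x u).re) h1
      simp only [inner_smul_right, inner_neg_right, Complex.re_ofReal_mul, Complex.neg_re] at h2
      have h3 : 0 ≤ (inner ℂ x (A⁻ (A⁻ x))).re := by
        rw [← hneg.isSelfAdjoint.isSymmetric.apply_clm, inner_self_eq_norm_sq_to_K]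
        exact_mod_cast sq_nonneg ‖A⁻ x‖
      have h4 := hinner _ hneg x
      exact apply_eq_zero_of_re_inner_eq_zero hneg (by nlinarith)
    have h1 : A⁺ x = A x := by
      have := DFunLike.congr_fun hsub x
      change A⁺ x - A⁻ x = A x at this
      rwa [h0, sub_zero] at this
    refine ⟨((μ : ℂ)⁻¹) • x, S.smul_mem _ hx, ?_⟩
    change A⁺ (((μ : ℂ)⁻¹) • x) = x
    rw [map_smul, h1, hxe, smul_smul, inv_mul_cancel₀ (by exact_mod_cast hμ.ne'), one_smul]
  · intro x hx hxG
    -- A⁺A⁺x lies in G since A⁺x ∈ S, so orthogonality to it already says ‖A⁺x‖² = 0.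
    have h1 : A⁺ x = 0 := by
      have h2 : inner ℂ (A⁺ (A⁺ x)) x = (0 : ℂ) := hxG _ ⟨A⁺ x, hSpos x hx, rfl⟩
      rw [hsymPos.apply_clm] at h2
      exact inner_self_eq_zero.mp h2
    have h2 : A x = -(A⁻ x) := by
      have := DFunLike.congr_fun hsub x
      change A⁺ x - A⁻ x = A x at this
      rw [← this, h1, zero_sub]
    rw [h2, inner_neg_right, Complex.neg_re]
    linarith [hinner _ hneg x]
  · rintro B hB hBS _ ⟨x, hx, rfl⟩
    exact ⟨B x, hBS x hx, (DFunLike.congr_fun (hcomm B hB) x).symm⟩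

end PositiveIndex

/-! ### Eigenvalue counts as dimensions -/

section Counting

variable {K : Type*} [NormedAddCommGroup K] [InnerProductSpace ℂ K]

theorem toENat_rank_eq_finrank (W : Submodule ℂ K) [FiniteDimensional ℂ W] :
    Cardinal.toENat (Module.rank ℂ W) = (Module.finrank ℂ W : ℕ∞) := by
  rw [← Module.finrank_eq_rank, Cardinal.toENat_nat]

theorem inner_eq_zero_of_apply_eq_smul {B : K →L[ℂ] K} (hB : (B : K →ₗ[ℂ] K).IsSymmetric)
    {a b : ℝ} (hab : a ≠ b) {x y : K} (hx : B x = (a : ℂ) • x) (hy : B y = (b : ℂ) • y) :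
    inner ℂ x y = 0 := by
  have h : inner ℂ (B x) y = inner ℂ x (B y) := hB x y
  rw [hx, hy, inner_smul_left, inner_smul_right, Complex.conj_ofReal] at h
  have h2 : ((a : ℂ) - b) * inner ℂ x y = 0 := by rw [sub_mul, h, sub_self]
  refine (mul_eq_zero.mp h2).resolve_left fun h3 => hab ?_
  exact_mod_cast sub_eq_zero.mp h3

/-- The eigenvalues of `T` in `I` are counted by the dimension of a finite-dimensional space that
contains their eigenvectors, is spanned by them, and is invariant under a symmetric operator `B`
with the same eigenvectors. -/
theorem eigenvalueCount_eq_finrank (T : K →ₗ.[ℂ] K) (I : Set ℝ) (G : Submodule ℂ K)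
    [FiniteDimensional ℂ G] (B : K →L[ℂ] K) (hB : (B : K →ₗ[ℂ] K).IsSymmetric)
    (hBG : ∀ x ∈ G, B x ∈ G) (β : ℝ → ℝ) (hβ : Set.InjOn β I)
    (hle : ∀ e ∈ I, eigenspace T e ≤ G)
    (heig : ∀ e ∈ I, ∀ x ∈ eigenspace T e, B x = (β e : ℂ) • x)
    (hspan : ∀ x ∈ G, x ≠ 0 → ∀ b : ℝ, B x = (b : ℂ) • x → ∃ e ∈ I, x ∈ eigenspace T e) :
    eigenvalueCount T I = Module.finrank ℂ G := by
  have hfin (e : ℝ) (he : e ∈ I) : FiniteDimensional ℂ (eigenspace T e) :=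
    Submodule.finiteDimensional_of_le (hle e he)
  apply le_antisymm
  · refine iSup₂_le fun s hs => ?_
    have hfin' (e : s) : FiniteDimensional ℂ (eigenspace T e) := hfin e (hs e.2)
    have hsum : ∑ e ∈ s, Cardinal.toENat (Module.rank ℂ (eigenspace T e)) =
        ((∑ e : s, Module.finrank ℂ (eigenspace T e) : ℕ) : ℕ∞) := by
      rw [← Finset.sum_coe_sort, Nat.cast_sum]
      exact Finset.sum_congr rfl fun e _ => toENat_rank_eq_finrank _
    rw [hsum, Nat.cast_le]
    -- Distinct e give distinct eigenvalues β e of the symmetric B, so the eigenspaces are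
    -- orthogonal and their direct sum embeds in G.
    have horth : OrthogonalFamily ℂ (fun e : s => eigenspace T e)
        fun e => (eigenspace T e).subtypeₗᵢ := by
      intro e e' hne x y
      exact inner_eq_zero_of_apply_eq_smul hB
        (fun h => hne (Subtype.ext (hβ (hs e.2) (hs e'.2) h)))
        (heig e (hs e.2) x x.2) (heig e' (hs e'.2) y y.2)
    have hind := horth.independent
    classical
    have hinj := hind.dfinsupp_lsum_injective
    rw [← Module.finrank_directSum]
    let f : (DirectSum s fun e => eigenspace T e) →ₗ[ℂ] G :=
      LinearMap.codRestrict G (DFinsupp.lsum ℕ fun e => (eigenspace T (e : ℝ)).subtype) (by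
        intro x
        rw [DFinsupp.lsum_apply_apply, DFinsupp.sumAddHom_apply]
        exact Submodule.sum_mem _ fun e _ => hle e (hs e.2) (x e).2)
    refine LinearMap.finrank_le_finrank_of_injective (f := f) fun x y hxy => hinj ?_
    exact congrArg Subtype.val hxy
  · obtain ⟨n, hn⟩ : ∃ n, Module.finrank ℂ G = n := ⟨_, rfl⟩
    -- For the reverse bound, B is diagonalized on G. Each basis vector lies in some eigenspace of
    -- T, and the basis is then grouped by the energy ε i.
    obtain ⟨b, ev, hb⟩ : ∃ (b : OrthonormalBasis (Fin n) ℂ G) (ev : Fin n → ℝ),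
        ∀ i, B (b i) = (ev i : ℂ) • (b i : K) := by
      let BG : G →ₗ[ℂ] G := (B : K →ₗ[ℂ] K).restrict hBG
      have hBGs : BG.IsSymmetric := fun x y => hB x y
      exact ⟨hBGs.eigenvectorBasis hn, hBGs.eigenvalues hn, fun i =>
        congrArg Subtype.val (hBGs.apply_eigenvectorBasis hn i)⟩
    have hbne (i) : (b i : K) ≠ 0 := by
      have h := b.orthonormal.ne_zero i
      exact fun h0 => h (Subtype.ext h0)
    choose ε hεI hε using fun i => hspan (b i) (b i).2 (hbne i) _ (hb i)
    classical
    let s := Finset.univ.image ε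
    have hs : (s : Set ℝ) ⊆ I := by
      intro e he
      obtain ⟨i, -, rfl⟩ := Finset.mem_image.mp (Finset.mem_coe.mp he)
      exact hεI i
    refine le_trans ?_ (le_iSup₂ (f := fun (s : Finset ℝ) (_ : (s : Set ℝ) ⊆ I) =>
      ∑ e ∈ s, Cardinal.toENat (Module.rank ℂ (eigenspace T e))) s hs)
    have hcard : n = ∑ e ∈ s, (Finset.univ.filter fun i => ε i = e).card := by
      have := Finset.card_eq_sum_card_image ε (Finset.univ : Finset (Fin n))
      rwa [Finset.card_univ, Fintype.card_fin] at this
    rw [hn, hcard, Nat.cast_sum]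
    refine Finset.sum_le_sum fun e he => ?_
    have := hfin e (hs he)
    rw [toENat_rank_eq_finrank, Nat.cast_le]
    let g : {i // ε i = e} → eigenspace T e := fun i => ⟨b i, by
      have h := hε i
      rwa [i.2] at h⟩
    have hg : LinearIndependent ℂ g := by
      have h0 : LinearIndependent ℂ b := b.orthonormal.linearIndependent
      have h1 : LinearIndependent ℂ (fun i => (b i : K)) := h0.map' G.subtype G.ker_subtype
      have h2 : LinearIndependent ℂ (fun i : {i // ε i = e} => (b i.1 : K)) :=
        h1.comp (Subtype.val : {i // ε i = e} → Fin n) Subtype.val_injective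
      exact LinearIndependent.of_comp (eigenspace T e).subtype h2
    have h2 := hg.fintype_card_le_finrank
    rwa [Fintype.card_subtype] at h2

end Counting

/-! ### Multiplication operators and composition with isometries -/

section Multiplication

variable {E : Type*} [NormedAddCommGroup E] [InnerProductSpace ℝ E] [FiniteDimensional ℝ E]
  [MeasurableSpace E] [BorelSpace E]

theorem coeFn_mulOp {g : E → ℂ} (hg : MemLp g ∞ volume) (f : L2 E) :
    mulOp g hg f =ᵐ[volume] fun x => g x * f x := by
  have h1 : mulOp g hg f =ᵐ[volume] fun x => hg.toLp g x * f x :=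
    (ContinuousLinearMap.mul ℂ ℂ).coeFn_holder (r := 2) (hg.toLp g) f
  filter_upwards [h1, hg.coeFn_toLp] with x h1 h2
  rw [h1, h2]

theorem mulOp_eq_smul {g : E → ℂ} (hg : MemLp g ∞ volume) (f : L2 E) :
    mulOp g hg f = (hg.toLp g • f : Lp ℂ 2 volume) := by
  apply Lp.ext
  filter_upwards [coeFn_mulOp hg f, Lp.coeFn_lpSMul (r := 2) (hg.toLp g) f, hg.coeFn_toLp]
    with x h1 h2 h3
  rw [h1, h2, Pi.smul_apply', h3, smul_eq_mul]

theorem inner_mulOp_left {g : E → ℝ} (hg : MemLp (fun x => (g x : ℂ)) ∞ volume) (f h : L2 E) :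
    inner ℂ (mulOp _ hg f) h = inner ℂ f (mulOp _ hg h) := by
  rw [L2.inner_def, L2.inner_def]
  refine integral_congr_ae ?_
  filter_upwards [coeFn_mulOp hg f, coeFn_mulOp hg h] with x h1 h2
  rw [h1, h2, RCLike.inner_apply, RCLike.inner_apply, map_mul, Complex.conj_ofReal]
  ring

theorem re_inner_mulOp_le {g h : E → ℝ} (hg : MemLp (fun x => (g x : ℂ)) ∞ volume)
    (hh : MemLp (fun x => (h x : ℂ)) ∞ volume) (hgh : ∀ x, g x ≤ h x) (f : L2 E) :
    (inner ℂ f (mulOp _ hg f)).re ≤ (inner ℂ f (mulOp _ hh f)).re := by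
  rw [L2.inner_def, L2.inner_def]
  have key {k : E → ℝ} (hk : MemLp (fun x => (k x : ℂ)) ∞ volume) :
      (∫ x, inner ℂ (f x) (mulOp _ hk f x)).re =
        ∫ x, (inner ℂ (f x) (mulOp _ hk f x)).re :=
    (integral_re (𝕜 := ℂ) (L2.integrable_inner f (mulOp _ hk f))).symm
  rw [key, key]
  refine integral_mono_ae (L2.integrable_inner (𝕜 := ℂ) f (mulOp _ hg f)).re
    (L2.integrable_inner (𝕜 := ℂ) f (mulOp _ hh f)).re ?_
  filter_upwards [coeFn_mulOp hg f, coeFn_mulOp hh f] with x h1 h2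
  have h3 (a : ℝ) : (inner ℂ (f x) ((a : ℂ) * f x)).re = a * ‖f x‖ ^ 2 := by
    rw [RCLike.inner_apply, mul_assoc, Complex.mul_conj, Complex.normSq_eq_norm_sq]
    norm_cast
  simp only [h1, h2]
  change (inner ℂ (f x) ((g x : ℂ) * f x)).re ≤ (inner ℂ (f x) ((h x : ℂ) * f x)).re
  rw [h3, h3]
  exact mul_le_mul_of_nonneg_right (hgh x) (sq_nonneg _)

theorem norm_mulOp_apply_le {g : E → ℂ} (hg : MemLp g ∞ volume) {C : ℝ}
    (h : ∀ x, ‖g x‖ ≤ C) (f : L2 E) : ‖mulOp g hg f‖ ≤ C * ‖f‖ := by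
  refine Lp.norm_le_mul_norm_of_ae_le_mul ?_
  filter_upwards [coeFn_mulOp hg f] with x h1
  rw [h1, norm_mul]
  exact mul_le_mul_of_nonneg_right (h x) (norm_nonneg _)

theorem coeFn_compOp (T : E ≃ₗᵢ[ℝ] E) (f : L2 E) :
    compOp T f =ᵐ[volume] fun x => f (T x) :=
  Lp.coeFn_compMeasurePreserving f T.measurePreserving

theorem compOp_mulOp (T : E ≃ₗᵢ[ℝ] E) {g h : E → ℂ} (hg : MemLp g ∞ volume)
    (hh : MemLp h ∞ volume) (hgh : ∀ x, g (T x) = h x) (f : L2 E) :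
    compOp T (mulOp g hg f) = mulOp h hh (compOp T f) := by
  apply Lp.ext
  have h1 := T.measurePreserving.quasiMeasurePreserving.ae_eq_comp (coeFn_mulOp hg f)
  filter_upwards [coeFn_compOp T (mulOp g hg f), coeFn_mulOp hh (compOp T f), coeFn_compOp T f, h1]
    with x h2 h3 h4 h5
  rw [h2, h3, h4, ← hgh]
  exact h5

theorem compOp_compOp (T U V : E ≃ₗᵢ[ℝ] E) (hTU : ∀ x, U (T x) = V x) (f : L2 E) :
    compOp T (compOp U f) = compOp V f := by
  apply Lp.ext
  have h1 := T.measurePreserving.quasiMeasurePreserving.ae_eq_comp (coeFn_compOp U f)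
  filter_upwards [coeFn_compOp T (compOp U f), coeFn_compOp V f, h1] with x h2 h3 h4
  rw [h2, h3, ← hTU]
  exact h4

theorem compOp_eq_self (T : E ≃ₗᵢ[ℝ] E) (hT : ∀ x, T x = x) (f : L2 E) : compOp T f = f := by
  apply Lp.ext
  filter_upwards [coeFn_compOp T f] with x h
  rw [h, hT]

theorem compOp_toLp (T : E ≃ₗᵢ[ℝ] E) (f : 𝓢(E, ℂ)) :
    compOp T (f.toLp 2) =
      (SchwartzMap.compCLMOfContinuousLinearEquiv ℂ T.toContinuousLinearEquiv f).toLp 2 := by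
  apply Lp.ext
  have h1 := T.measurePreserving.quasiMeasurePreserving.ae_eq_comp
    (SchwartzMap.coeFn_toLp f 2 (volume : Measure E))
  filter_upwards [coeFn_compOp T (f.toLp 2), SchwartzMap.coeFn_toLp
    (SchwartzMap.compCLMOfContinuousLinearEquiv ℂ T.toContinuousLinearEquiv f) 2
      (volume : Measure E), h1] with x h2 h3 h4
  rw [h2, h3]
  exact h4

/-- For Schwartz functions this is a change of variables in the Fourier integral; density extends it
to L². -/
theorem fourier_compOp (T : E ≃ₗᵢ[ℝ] E) (f : L2 E) : 𝓕 (compOp T f) = compOp T (𝓕 f) := by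
  refine DenseRange.induction_on (p := fun f : L2 E => 𝓕 (compOp T f) = compOp T (𝓕 f))
    (SchwartzMap.denseRange_toLpCLM (p := 2) ENNReal.ofNat_ne_top) f ?_ fun f => ?_
  · exact isClosed_eq ((Lp.fourierTransformₗᵢ E ℂ).continuous.comp (compOp T).continuous)
      ((compOp T).continuous.comp (Lp.fourierTransformₗᵢ E ℂ).continuous)
  · rw [SchwartzMap.toLpCLM_apply, SchwartzMap.toLp_fourier_eq, compOp_toLp, compOp_toLp,
      SchwartzMap.toLp_fourier_eq]
    congr 1
    ext x
    rw [SchwartzMap.fourier_coe]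
    exact Real.fourier_comp_linearIsometry T f x

end Multiplication

/-! ### Fourier multipliers on L² and on tempered distributions -/

section FourierMultiplier

/-- A power of 1 + ‖·‖² after rescaling: this form yields temperate growth of the symbol. -/
theorem resolventSymbol_eq {E : Type*} [NormedAddCommGroup E] [InnerProductSpace ℝ E]
    (z : ℝ) (hz : 0 < z) (ξ : E) :
    ((2 * Real.pi * ‖ξ‖) ^ 2 + z ^ 2)⁻¹ =
      (z ^ 2)⁻¹ * (1 + ‖(2 * Real.pi / z) • ξ‖ ^ 2) ^ (-1 : ℝ) := by
  rw [Real.rpow_neg_one, ← mul_inv, norm_smul, Real.norm_eq_abs, abs_of_nonneg (by positivity)]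
  congr 1
  field_simp
  ring

theorem hasTemperateGrowth_resolventSymbol {E : Type*} [NormedAddCommGroup E] [InnerProductSpace ℝ E]
    (z : ℝ) (hz : 0 < z) :
    (fun ξ : E => ((((2 * Real.pi * ‖ξ‖) ^ 2 + z ^ 2)⁻¹ : ℝ) : ℂ)).HasTemperateGrowth := by
  simp_rw [resolventSymbol_eq z hz]
  have h1 : (fun ξ : E => (1 + ‖(2 * Real.pi / z) • ξ‖ ^ 2) ^ (-1 : ℝ)).HasTemperateGrowth :=
    (Function.hasTemperateGrowth_one_add_norm_sq_rpow E (-1)).comp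
      ((2 * Real.pi / z) • ContinuousLinearMap.id ℝ E).hasTemperateGrowth
  fun_prop

variable {E : Type*} [NormedAddCommGroup E] [InnerProductSpace ℝ E] [FiniteDimensional ℝ E]
  [MeasurableSpace E] [BorelSpace E]

/-- The Fourier multiplier `g(p)` with an essentially bounded symbol. -/
noncomputable def fourierMulOp (g : E → ℂ) (hg : MemLp g ∞ volume) : L2 E →L[ℂ] L2 E :=
  (Lp.fourierTransformₗᵢ E ℂ).symm.toContinuousLinearEquiv.toContinuousLinearMap ∘L
    mulOp g hg ∘L (Lp.fourierTransformₗᵢ E ℂ).toContinuousLinearEquiv.toContinuousLinearMap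

theorem fourier_fourierMulOp {g : E → ℂ} (hg : MemLp g ∞ volume) (f : L2 E) :
    𝓕 (fourierMulOp g hg f) = mulOp g hg (𝓕 f) :=
  (Lp.fourierTransformₗᵢ E ℂ).apply_symm_apply _

theorem resolvent_eq_fourierMulOp (z : ℝ) (hz : 0 < z) :
    resolvent E z hz = fourierMulOp _ (resolventSymbol_memLp z hz) := rfl

theorem inner_fourierMulOp (f h : L2 E) {g : E → ℂ} (hg : MemLp g ∞ volume) :
    inner ℂ f (fourierMulOp g hg h) = inner ℂ (𝓕 f) (mulOp g hg (𝓕 h)) := by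
  rw [← fourier_fourierMulOp, Lp.inner_fourier_eq]

theorem norm_fourierMulOp_apply_le {g : E → ℂ} (hg : MemLp g ∞ volume) {C : ℝ}
    (h : ∀ x, ‖g x‖ ≤ C) (f : L2 E) : ‖fourierMulOp g hg f‖ ≤ C * ‖f‖ := by
  rw [← Lp.norm_fourier_eq, fourier_fourierMulOp, ← Lp.norm_fourier_eq f]
  exact norm_mulOp_apply_le hg h _

theorem inner_fourierMulOp_left {g : E → ℝ} (hg : MemLp (fun x => (g x : ℂ)) ∞ volume)
    (f h : L2 E) : inner ℂ (fourierMulOp _ hg f) h = inner ℂ f (fourierMulOp _ hg h) := by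
  rw [inner_fourierMulOp, ← inner_mulOp_left, ← fourier_fourierMulOp, Lp.inner_fourier_eq]

theorem compOp_fourierMulOp (T : E ≃ₗᵢ[ℝ] E) {g : E → ℂ} (hg : MemLp g ∞ volume)
    (hT : ∀ x, g (T x) = g x) (f : L2 E) :
    compOp T (fourierMulOp g hg f) = fourierMulOp g hg (compOp T f) := by
  apply (Lp.fourierTransformₗᵢ E ℂ).injective
  change 𝓕 (compOp T (fourierMulOp g hg f)) = 𝓕 (fourierMulOp g hg (compOp T f))
  rw [fourier_compOp, fourier_fourierMulOp, fourier_fourierMulOp, fourier_compOp,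
    compOp_mulOp T hg hg hT]

theorem compOp_resolvent (T : E ≃ₗᵢ[ℝ] E) (z : ℝ) (hz : 0 < z) (f : L2 E) :
    compOp T (resolvent E z hz f) = resolvent E z hz (compOp T f) :=
  compOp_fourierMulOp T _ (fun x => by rw [T.norm_map]) f

theorem inner_resolvent_left (z : ℝ) (hz : 0 < z) (f h : L2 E) :
    inner ℂ (resolvent E z hz f) h = inner ℂ f (resolvent E z hz h) :=
  inner_fourierMulOp_left (resolventSymbol_memLp z hz) f h

/-- The bridge to the distributional definitions of -Δ and H²: the L² multiplier agrees with the one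
on tempered distributions. -/
theorem toDistrib_fourierMulOp {g : E → ℂ} (hg : MemLp g ∞ volume) (hg' : g.HasTemperateGrowth)
    (f : L2 E) : toDistrib E (fourierMulOp g hg f) =
      TemperedDistribution.fourierMultiplierCLM ℂ g (toDistrib E f) := by
  have h := fourier_fourierMulOp hg f
  have h2 : fourierMulOp g hg f = 𝓕⁻ (mulOp g hg (𝓕 f)) := by
    rw [← h, FourierTransform.fourierInv_fourier_eq]
  rw [TemperedDistribution.fourierMultiplierCLM_apply, h2]
  change Lp.toTemperedDistribution (𝓕⁻ (mulOp g hg (𝓕 f))) =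
    𝓕⁻ (TemperedDistribution.smulLeftCLM ℂ g (𝓕 (Lp.toTemperedDistribution f)))
  rw [← Lp.fourierInv_toTemperedDistribution_eq, mulOp_eq_smul,
    Lp.toTemperedDistribution_smul_eq hg', Lp.fourier_toTemperedDistribution_eq]

end FourierMultiplier

/-! ### The free resolvent as inverse of -Δ + z² -/

section Resolvent

theorem hasTemperateGrowth_inv_resolventSymbol {E : Type*} [NormedAddCommGroup E]
    [InnerProductSpace ℝ E] (z : ℝ) :
    (fun ξ : E => (((2 * Real.pi * ‖ξ‖) ^ 2 + z ^ 2 : ℝ) : ℂ)).HasTemperateGrowth := by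
  simp_rw [mul_pow]
  fun_prop

/-- The resolvent gains two derivatives: this bound puts its range in H². -/
theorem one_add_norm_sq_mul_resolventSymbol_le {E : Type*} [NormedAddCommGroup E]
    (z : ℝ) (hz : 0 < z) (ξ : E) :
    (1 + ‖ξ‖ ^ 2) * ((2 * Real.pi * ‖ξ‖) ^ 2 + z ^ 2)⁻¹ ≤ 1 + (z ^ 2)⁻¹ := by
  have hd : 0 < (2 * Real.pi * ‖ξ‖) ^ 2 + z ^ 2 := by positivity
  rw [← div_eq_mul_inv, div_le_iff₀ hd]
  have h1 : (z ^ 2)⁻¹ * z ^ 2 = 1 := inv_mul_cancel₀ (by positivity)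
  have h2 : 0 ≤ (z ^ 2)⁻¹ * (2 * Real.pi * ‖ξ‖) ^ 2 := by positivity
  have h3 : ‖ξ‖ ^ 2 ≤ (2 * Real.pi * ‖ξ‖) ^ 2 := by
    have : 1 ≤ 2 * Real.pi := by linarith [Real.pi_gt_three]
    gcongr
    nlinarith [norm_nonneg ξ]
  nlinarith [sq_nonneg z]

variable {E : Type*} [NormedAddCommGroup E] [InnerProductSpace ℝ E] [FiniteDimensional ℝ E]
  [MeasurableSpace E] [BorelSpace E]

theorem toDistrib_negLaplacian (ψ : (negLaplacian E).domain) :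
    toDistrib E (negLaplacian E ψ) = -Δ (toDistrib E (ψ : L2 E)) := by
  refine Eq.trans ?_ (distribNegLaplacian_apply (E := E) ψ)
  have h := (LinearEquiv.ofInjective (toDistrib E) toDistrib_injective).apply_symm_apply
    ((distribNegLaplacian E).codRestrict _ distribNegLaplacian_mem_range ψ)
  exact congrArg Subtype.val h

theorem laplacian_eq_fourierMultiplier (u : 𝓢'(E, ℂ)) :
    -Δ u = TemperedDistribution.fourierMultiplierCLM ℂ
      (fun ξ : E => (((2 * Real.pi * ‖ξ‖) ^ 2 : ℝ) : ℂ)) u := by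
  have h : (fun ξ : E => (((2 * Real.pi * ‖ξ‖) ^ 2 : ℝ) : ℂ)) =
      (((2 * Real.pi) ^ 2 : ℝ) : ℂ) • fun ξ : E => ((‖ξ‖ ^ 2 : ℝ) : ℂ) := by
    ext ξ
    simp only [Pi.smul_apply, smul_eq_mul, mul_pow, Complex.ofReal_mul]
  have hsm := TemperedDistribution.fourierMultiplierCLM_smul (F := ℂ)
    (g := fun ξ : E => ((‖ξ‖ ^ 2 : ℝ) : ℂ)) (by fun_prop) (((2 * Real.pi) ^ 2 : ℝ) : ℂ)
  rw [TemperedDistribution.laplacian_eq_fourierMultiplierCLM, h, hsm, neg_smul, neg_neg]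
  rfl

theorem neg_laplacian_add_eq_fourierMultiplier (z : ℝ) (u : 𝓢'(E, ℂ)) :
    -Δ u + (z : ℂ) ^ 2 • u = TemperedDistribution.fourierMultiplierCLM ℂ
      (fun ξ : E => (((2 * Real.pi * ‖ξ‖) ^ 2 + z ^ 2 : ℝ) : ℂ)) u := by
  have hg : (fun ξ : E => (((2 * Real.pi * ‖ξ‖) ^ 2 : ℝ) : ℂ)).HasTemperateGrowth := by
    simp_rw [mul_pow]
    fun_prop
  have h2 : (fun ξ : E => (((z ^ 2 : ℝ) : ℂ))).HasTemperateGrowth := by fun_prop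
  have h1 : (z : ℂ) ^ 2 • u = TemperedDistribution.fourierMultiplierCLM ℂ
      (fun _ : E => ((z ^ 2 : ℝ) : ℂ)) u := by
    rw [TemperedDistribution.fourierMultiplierCLM_const]
    simp
  have h3 : (fun ξ : E => (((2 * Real.pi * ‖ξ‖) ^ 2 + z ^ 2 : ℝ) : ℂ)) =
      (fun ξ : E => (((2 * Real.pi * ‖ξ‖) ^ 2 : ℝ) : ℂ)) + fun ξ : E => (((z ^ 2 : ℝ) : ℂ)) := by
    ext ξ
    simp
  rw [laplacian_eq_fourierMultiplier, h1, h3]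
  simp only [TemperedDistribution.fourierMultiplierCLM_apply]
  rw [TemperedDistribution.smulLeftCLM_add hg h2, add_apply,
    FourierTransform.fourierInv_add]

theorem fourierMultiplier_resolventSymbol (z : ℝ) (hz : 0 < z) (u : 𝓢'(E, ℂ)) :
    TemperedDistribution.fourierMultiplierCLM ℂ
      (fun ξ : E => ((((2 * Real.pi * ‖ξ‖) ^ 2 + z ^ 2)⁻¹ : ℝ) : ℂ))
      (-Δ u + (z : ℂ) ^ 2 • u) = u := by
  rw [neg_laplacian_add_eq_fourierMultiplier,
    TemperedDistribution.fourierMultiplierCLM_fourierMultiplierCLM_apply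
      (hasTemperateGrowth_inv_resolventSymbol z) (hasTemperateGrowth_resolventSymbol z hz)]
  have h : ((fun ξ : E => (((2 * Real.pi * ‖ξ‖) ^ 2 + z ^ 2 : ℝ) : ℂ)) *
      fun ξ : E => ((((2 * Real.pi * ‖ξ‖) ^ 2 + z ^ 2)⁻¹ : ℝ) : ℂ)) = fun _ => 1 := by
    ext ξ
    rw [Pi.mul_apply, ← Complex.ofReal_mul, mul_inv_cancel₀ (by positivity), Complex.ofReal_one]
  rw [h, TemperedDistribution.fourierMultiplierCLM_const]
  simp

theorem neg_laplacian_add_fourierMultiplier_resolventSymbol (z : ℝ) (hz : 0 < z) (u : 𝓢'(E, ℂ)) :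
    -Δ (TemperedDistribution.fourierMultiplierCLM ℂ
      (fun ξ : E => ((((2 * Real.pi * ‖ξ‖) ^ 2 + z ^ 2)⁻¹ : ℝ) : ℂ)) u) +
      (z : ℂ) ^ 2 • (TemperedDistribution.fourierMultiplierCLM ℂ
      (fun ξ : E => ((((2 * Real.pi * ‖ξ‖) ^ 2 + z ^ 2)⁻¹ : ℝ) : ℂ)) u) = u := by
  rw [neg_laplacian_add_eq_fourierMultiplier,
    TemperedDistribution.fourierMultiplierCLM_fourierMultiplierCLM_apply
      (hasTemperateGrowth_resolventSymbol z hz) (hasTemperateGrowth_inv_resolventSymbol z)]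
  have h : ((fun ξ : E => ((((2 * Real.pi * ‖ξ‖) ^ 2 + z ^ 2)⁻¹ : ℝ) : ℂ)) *
      fun ξ : E => (((2 * Real.pi * ‖ξ‖) ^ 2 + z ^ 2 : ℝ) : ℂ)) = fun _ => 1 := by
    ext ξ
    rw [Pi.mul_apply, ← Complex.ofReal_mul, inv_mul_cancel₀ (by positivity), Complex.ofReal_one]
  rw [h, TemperedDistribution.fourierMultiplierCLM_const]
  simp

theorem toDistrib_resolvent (z : ℝ) (hz : 0 < z) (η : L2 E) :
    toDistrib E (resolvent E z hz η) = TemperedDistribution.fourierMultiplierCLM ℂ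
      (fun ξ : E => ((((2 * Real.pi * ‖ξ‖) ^ 2 + z ^ 2)⁻¹ : ℝ) : ℂ)) (toDistrib E η) :=
  toDistrib_fourierMulOp _ (hasTemperateGrowth_resolventSymbol z hz) η

theorem resolvent_mem_sobolev2 (z : ℝ) (hz : 0 < z) (η : L2 E) :
    resolvent E z hz η ∈ sobolev2 E := by
  change TemperedDistribution.MemSobolev 2 2 (toDistrib E (resolvent E z hz η))
  rw [toDistrib_resolvent]
  have h0 : TemperedDistribution.MemSobolev 0 2 (toDistrib E η) :=
    TemperedDistribution.memSobolev_zero_iff.mpr ⟨η, rfl⟩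
  have hr := hasTemperateGrowth_resolventSymbol (E := E) z hz
  have hb : (fun ξ : E => (((1 + ‖ξ‖ ^ 2) ^ ((2 : ℝ) / 2) : ℝ) : ℂ)).HasTemperateGrowth := by
    fun_prop
  have h1 := h0.fourierMultiplierCLM_of_bounded (g := (fun ξ : E =>
    ((((2 * Real.pi * ‖ξ‖) ^ 2 + z ^ 2)⁻¹ : ℝ) : ℂ)) * fun ξ : E =>
      (((1 + ‖ξ‖ ^ 2) ^ ((2 : ℝ) / 2) : ℝ) : ℂ)) (hr.mul hb) ⟨1 + (z ^ 2)⁻¹, fun ξ => by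
      rw [Pi.mul_apply, ← Complex.ofReal_mul, Complex.norm_real, Real.norm_eq_abs,
        abs_of_nonneg (by positivity), div_self two_ne_zero, Real.rpow_one, mul_comm]
      exact one_add_norm_sq_mul_resolventSymbol_le z hz ξ⟩
  rw [← TemperedDistribution.fourierMultiplierCLM_fourierMultiplierCLM_apply hr hb,
    TemperedDistribution.memSobolev_zero_iff] at h1
  exact h1

theorem negLaplacian_resolvent (z : ℝ) (hz : 0 < z) (η : L2 E)
    (h : resolvent E z hz η ∈ (negLaplacian E).domain) :
    negLaplacian E ⟨resolvent E z hz η, h⟩ =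
      η - (z : ℂ) ^ 2 • resolvent E z hz η := by
  apply toDistrib_injective
  rw [toDistrib_negLaplacian, map_sub, map_smul, toDistrib_resolvent]
  exact eq_sub_of_add_eq (neg_laplacian_add_fourierMultiplier_resolventSymbol z hz _)

theorem resolvent_negLaplacian (z : ℝ) (hz : 0 < z) (ψ : (negLaplacian E).domain) :
    resolvent E z hz (negLaplacian E ψ + (z : ℂ) ^ 2 • (ψ : L2 E)) = ψ := by
  apply toDistrib_injective
  rw [toDistrib_resolvent, map_add, map_smul, toDistrib_negLaplacian]
  exact fourierMultiplier_resolventSymbol z hz _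

/-- The symbol m satisfies z²m² ≤ m, because m ≤ z⁻². With ψ the resolvent of η, the inequality
expresses ⟨ψ, -Δψ⟩ ≥ 0 through bounded operators. -/
theorem sq_mul_norm_resolvent_sq_le (z : ℝ) (hz : 0 < z) (η : L2 E) :
    z ^ 2 * ‖resolvent E z hz η‖ ^ 2 ≤ (inner ℂ η (resolvent E z hz η)).re := by
  have hm := resolventSymbol_memLp (E := E) z hz
  have hm2 : MemLp (fun ξ : E => ((((z ^ 2) * (((2 * Real.pi * ‖ξ‖) ^ 2 + z ^ 2)⁻¹ *
      ((2 * Real.pi * ‖ξ‖) ^ 2 + z ^ 2)⁻¹) : ℝ)) : ℂ)) ∞ volume := by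
    refine memLp_top_ofReal (C := (z ^ 2)⁻¹) (by fun_prop) fun ξ => ?_
    rw [abs_of_nonneg (by positivity)]
    have h1 : ((2 * Real.pi * ‖ξ‖) ^ 2 + z ^ 2)⁻¹ ≤ (z ^ 2)⁻¹ := by
      gcongr
      nlinarith [sq_nonneg (2 * Real.pi * ‖ξ‖)]
    calc _ ≤ z ^ 2 * ((z ^ 2)⁻¹ * (z ^ 2)⁻¹) := by gcongr
      _ = _ := by field_simp
  have h1 := re_inner_mulOp_le hm2 hm (fun ξ => by
    have hd : 0 < (2 * Real.pi * ‖ξ‖) ^ 2 + z ^ 2 := by positivity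
    rw [← mul_assoc]
    refine mul_le_of_le_one_left (by positivity) ?_
    rw [← div_eq_mul_inv, div_le_one hd]
    nlinarith [sq_nonneg (2 * Real.pi * ‖ξ‖)]) (𝓕 η)
  rw [resolvent_eq_fourierMulOp, inner_fourierMulOp]
  refine le_trans (le_of_eq ?_) h1
  have h2 : mulOp _ hm2 (𝓕 η) = ((z ^ 2 : ℝ) : ℂ) • mulOp _ hm (mulOp _ hm (𝓕 η)) := by
    apply Lp.ext
    filter_upwards [coeFn_mulOp hm2 (𝓕 η), coeFn_mulOp hm (𝓕 η),
      coeFn_mulOp hm (mulOp _ hm (𝓕 η)), Lp.coeFn_smul ((z ^ 2 : ℝ) : ℂ)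
        (mulOp _ hm (mulOp _ hm (𝓕 η)))] with ξ h1 h2 h3 h4
    rw [h1, h4, Pi.smul_apply, h3, h2, Complex.ofReal_mul, Complex.ofReal_mul, smul_eq_mul,
      mul_assoc, mul_assoc]
  rw [h2, inner_smul_right, ← inner_mulOp_left hm, inner_self_eq_norm_sq_to_K,
    ← fourier_fourierMulOp, Lp.norm_fourier_eq, Complex.re_ofReal_mul]
  norm_cast

theorem resolvent_nonneg (z : ℝ) (hz : 0 < z) : 0 ≤ resolvent E z hz := by
  rw [ContinuousLinearMap.nonneg_iff_isPositive]
  refine ⟨fun x y => inner_resolvent_left z hz x y, fun x => ?_⟩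
  have h := sq_mul_norm_resolvent_sq_le z hz x
  change 0 ≤ RCLike.re (inner ℂ (resolvent E z hz x) x)
  rw [inner_resolvent_left]
  exact le_trans (by positivity) h

theorem norm_resolvent_le (z : ℝ) (hz : 0 < z) : ‖resolvent E z hz‖ ≤ (z ^ 2)⁻¹ := by
  refine ContinuousLinearMap.opNorm_le_bound _ (by positivity) fun η => ?_
  refine norm_fourierMulOp_apply_le _ (fun ξ => ?_) η
  rw [Complex.norm_real, Real.norm_eq_abs, abs_of_nonneg (by positivity)]
  gcongr
  nlinarith [sq_nonneg (2 * Real.pi * ‖ξ‖)]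

end Resolvent

/-! ### Particle permutations and the factorization of M(z) -/

section Permutations

/-- `norm_jacobi_sq` makes the Jacobi map injective on configurations with center of mass zero, so
its right inverse is two-sided there. -/
theorem position_jacobi {r : Fin 3 → Plane} (hr : ∑ i, r i = 0) : position (jacobi r) = r := by
  have h1 : ∑ i, (position (jacobi r) - r) i = 0 := by
    simp only [Pi.sub_apply, Finset.sum_sub_distrib, sum_position, hr, sub_zero]
  have h2 := norm_jacobi_sq _ h1
  rw [map_sub, jacobi_position, sub_self, norm_zero, Fin.sum_univ_three] at h2
  ext1 i
  rw [← sub_eq_zero, ← norm_eq_zero, ← sq_eq_zero_iff]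
  have h3 (i) := sq_nonneg ‖(position (jacobi r) - r) i‖
  have h30 := h3 0
  have h31 := h3 1
  have h32 := h3 2
  change ‖(position (jacobi r) - r) i‖ ^ 2 = 0
  fin_cases i <;> simp only [Fin.zero_eta, Fin.mk_one, Fin.reduceFinMk] <;> linarith

theorem position_permIsometry (p : Equiv.Perm (Fin 3)) (X : Config) (i : Fin 3) :
    position (permIsometry p X) i = position X (p i) := by
  have h : ∑ i, (position X ∘ p) i = 0 := (Equiv.sum_comp p (position X)).trans (sum_position X)
  exact congrFun (position_jacobi h) i

theorem permIsometry_permIsometry (p q : Equiv.Perm (Fin 3)) (X : Config) :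
    permIsometry q (permIsometry p X) = permIsometry (p * q) X := by
  rw [← jacobi_position (permIsometry q (permIsometry p X)),
    ← jacobi_position (permIsometry (p * q) X)]
  congr 1
  ext1 i
  simp only [position_permIsometry, Equiv.Perm.mul_apply]

theorem permOp_permOp (p q : Equiv.Perm (Fin 3)) (f : L2 Config) :
    permOp p (permOp q f) = permOp (p * q) f :=
  compOp_compOp _ _ _ (permIsometry_permIsometry p q) f

theorem permOp_one (f : L2 Config) : permOp 1 f = f := by
  refine compOp_eq_self _ (fun X => ?_) f
  rw [← jacobi_position (permIsometry 1 X)]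
  conv_rhs => rw [← jacobi_position X]
  congr 1
  ext1 i
  rw [position_permIsometry, Equiv.Perm.one_apply]

/-- The pair complementary to α is carried to the pair complementary to p α, possibly in reversed
order, which the distance does not see. -/
theorem perm_pair (p : Equiv.Perm (Fin 3)) (α : Fin 3) :
    (p (α + 1) = p α + 1 ∧ p (α + 2) = p α + 2) ∨ (p (α + 1) = p α + 2 ∧ p (α + 2) = p α + 1) := by
  revert p α
  decide

theorem pairPotential_permIsometry (v : PairInteraction) (p : Equiv.Perm (Fin 3)) (α : Fin 3)
    (X : Config) : pairPotential v α (permIsometry p X) = pairPotential v (p α) X := by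
  unfold pairPotential
  rw [position_permIsometry, position_permIsometry]
  rcases perm_pair p α with h | h
  · rw [h.1, h.2]
  · rw [h.1, h.2, norm_sub_rev]

theorem permOp_sqrtPotentialOp (v : PairInteraction) (p : Equiv.Perm (Fin 3)) (α : Fin 3)
    (f : L2 Config) :
    permOp p (sqrtPotentialOp v α f) = sqrtPotentialOp v (p α) (permOp p f) :=
  compOp_mulOp _ _ _ (fun X => by rw [pairPotential_permIsometry]) f

theorem permOp_resolvent (p : Equiv.Perm (Fin 3)) (z : ℝ) (hz : 0 < z) (f : L2 Config) :
    permOp p (resolvent Config z hz f) = resolvent Config z hz (permOp p f) :=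
  compOp_resolvent _ z hz f

/-- The sign v ≤ 0 enters here: it gives -v_α = |v_α|, which is a square. -/
theorem potentialOp_eq (v : PairInteraction) (α : Fin 3) (f : L2 Config) :
    potentialOp v α f = -sqrtPotentialOp v α (sqrtPotentialOp v α f) := by
  apply Lp.ext
  filter_upwards [coeFn_mulOp (memLp_pairPotential v α) f,
    coeFn_mulOp (memLp_sqrt_pairPotential v α) f,
    coeFn_mulOp (memLp_sqrt_pairPotential v α) (sqrtPotentialOp v α f),
    Lp.coeFn_neg (sqrtPotentialOp v α (sqrtPotentialOp v α f))] with X h1 h2 h3 h4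
  rw [h4, Pi.neg_apply]
  unfold potentialOp sqrtPotentialOp at *
  have hneg : pairPotential v α X ≤ 0 := v.nonpos _ (norm_nonneg _)
  rw [h1, h3, h2, ← mul_assoc, ← Complex.ofReal_mul, Real.mul_self_sqrt (abs_nonneg _),
    abs_of_nonpos hneg, Complex.ofReal_neg, neg_mul, neg_neg]

theorem isClosed_antisymmetricSubspace :
    IsClosed (antisymmetricSubspace : Set (L2 Config)) := by
  have h : (antisymmetricSubspace : Set (L2 Config)) = ⋂ p : Equiv.Perm (Fin 3),
      {ψ | permOp p ψ = ((Equiv.Perm.sign p : ℤ) : ℂ) • ψ} := by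
    ext ψ
    rw [Set.mem_iInter]
    rfl
  rw [h]
  exact isClosed_iInter fun p => isClosed_eq (permOp p).continuous (continuous_const_smul _)

theorem isClosed_faddeevSpace : IsClosed (faddeevSpace : Set TripleL2) := by
  have h : (faddeevSpace : Set TripleL2) = ⋂ (i : Fin 3) (k : Fin 3) (_ : i ≠ k) (α : Fin 3),
      {φ | permOp (Equiv.swap i k) (φ α) = -φ (Equiv.swap i k α)} := by
    ext φ
    simp only [Set.mem_iInter]
    rfl
  rw [h]
  refine isClosed_iInter fun i => isClosed_iInter fun k => isClosed_iInter fun _ =>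
    isClosed_iInter fun α => isClosed_eq ?_ ?_
  · exact (permOp _).continuous.comp (PiLp.continuous_apply 2 _ α)
  · exact (PiLp.continuous_apply 2 _ _).neg

instance : antisymmetricSubspace.HasOrthogonalProjection :=
  have : CompleteSpace antisymmetricSubspace :=
    isClosed_antisymmetricSubspace.completeSpace_coe
  inferInstance

instance : faddeevSpace.HasOrthogonalProjection :=
  have : CompleteSpace faddeevSpace := isClosed_faddeevSpace.completeSpace_coe
  inferInstance

/-- The operator `ψ ↦ (|v_α|^{1/2} ψ)_α`. -/
noncomputable def sqrtPotentialVec (v : PairInteraction) : L2 Config →L[ℂ] TripleL2 :=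
  (PiLp.continuousLinearEquiv 2 ℂ fun _ : Fin 3 => L2 Config).symm.toContinuousLinearMap ∘L
    ContinuousLinearMap.pi fun α => sqrtPotentialOp v α

/-- The operator `φ ↦ ∑_α |v_α|^{1/2} φ_α`. -/
noncomputable def sqrtPotentialSum (v : PairInteraction) : TripleL2 →L[ℂ] L2 Config :=
  ∑ α, sqrtPotentialOp v α ∘L PiLp.proj 2 (fun _ : Fin 3 => L2 Config) α

theorem sqrtPotentialVec_apply (v : PairInteraction) (ψ : L2 Config) (α : Fin 3) :
    sqrtPotentialVec v ψ α = sqrtPotentialOp v α ψ := rfl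

theorem sqrtPotentialSum_apply (v : PairInteraction) (φ : TripleL2) :
    sqrtPotentialSum v φ = ∑ α, sqrtPotentialOp v α (φ α) := by
  rw [sqrtPotentialSum, sum_apply]
  rfl

/-- The factorization M(z) = T R T*, the only form of M(z) that the Birman–Schwinger argument needs.
-/
theorem birmanSchwingerMatrix_apply (v : PairInteraction) (z : ℝ) (hz : 0 < z) (φ : TripleL2) :
    birmanSchwingerMatrix v z hz φ =
      sqrtPotentialVec v (resolvent Config z hz (sqrtPotentialSum v φ)) := by
  ext1 α
  rw [sqrtPotentialVec_apply, sqrtPotentialSum_apply, map_sum, map_sum]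
  change (∑ β, birmanSchwingerEntry v z hz α β ∘L PiLp.proj 2 (fun _ : Fin 3 => L2 Config) β) φ = _
  rw [sum_apply]
  rfl

theorem inner_sqrtPotentialOp_left (v : PairInteraction) (α : Fin 3) (f g : L2 Config) :
    inner ℂ (sqrtPotentialOp v α f) g = inner ℂ f (sqrtPotentialOp v α g) :=
  inner_mulOp_left (memLp_sqrt_pairPotential v α) f g

theorem inner_sqrtPotentialVec_left (v : PairInteraction) (ψ : L2 Config) (φ : TripleL2) :
    inner ℂ (sqrtPotentialVec v ψ) φ = inner ℂ ψ (sqrtPotentialSum v φ) := by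
  rw [PiLp.inner_apply, sqrtPotentialSum_apply, inner_sum]
  exact Finset.sum_congr rfl fun α _ => inner_sqrtPotentialOp_left v α ψ (φ α)

theorem inner_sqrtPotentialSum_left (v : PairInteraction) (φ : TripleL2) (ψ : L2 Config) :
    inner ℂ (sqrtPotentialSum v φ) ψ = inner ℂ φ (sqrtPotentialVec v ψ) := by
  rw [← inner_conj_symm, ← inner_sqrtPotentialVec_left, inner_conj_symm]

theorem sum_potentialOp_eq (v : PairInteraction) (ψ : L2 Config) :
    (∑ α, potentialOp v α) ψ = -sqrtPotentialSum v (sqrtPotentialVec v ψ) := by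
  rw [sum_apply, sqrtPotentialSum_apply, ← Finset.sum_neg_distrib]
  exact Finset.sum_congr rfl fun α _ => potentialOp_eq v α ψ

/-- Transpositions generate the symmetric group. -/
theorem mem_antisymmetricSubspace_of_swap {ψ : L2 Config}
    (h : ∀ i k : Fin 3, i ≠ k → permOp (Equiv.swap i k) ψ = -ψ) : ψ ∈ antisymmetricSubspace := by
  intro p
  induction p using Equiv.Perm.swap_induction_on with
  | one => simp [permOp_one]
  | swap_mul p i k hik ih =>
    rw [← permOp_permOp, ih, map_smul, h i k hik, Equiv.Perm.sign_mul, Equiv.Perm.sign_swap hik]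
    simp

theorem permOp_swap_of_mem {ψ : L2 Config} (h : ψ ∈ antisymmetricSubspace) {i k : Fin 3}
    (hik : i ≠ k) : permOp (Equiv.swap i k) ψ = -ψ := by
  rw [h (Equiv.swap i k), Equiv.Perm.sign_swap hik]
  simp

theorem resolvent_mem_antisymmetricSubspace {ψ : L2 Config} (h : ψ ∈ antisymmetricSubspace)
    (z : ℝ) (hz : 0 < z) : resolvent Config z hz ψ ∈ antisymmetricSubspace := by
  intro p
  rw [permOp_resolvent, h p, map_smul]

theorem sqrtPotentialVec_mem_faddeevSpace (v : PairInteraction) {ψ : L2 Config}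
    (h : ψ ∈ antisymmetricSubspace) : sqrtPotentialVec v ψ ∈ faddeevSpace := by
  intro i k hik α
  rw [sqrtPotentialVec_apply, sqrtPotentialVec_apply, permOp_sqrtPotentialOp,
    permOp_swap_of_mem h hik, map_neg]

theorem sqrtPotentialSum_mem_antisymmetricSubspace (v : PairInteraction) {φ : TripleL2}
    (h : φ ∈ faddeevSpace) : sqrtPotentialSum v φ ∈ antisymmetricSubspace := by
  refine mem_antisymmetricSubspace_of_swap fun i k hik => ?_
  rw [sqrtPotentialSum_apply, map_sum, ← Finset.sum_neg_distrib,
    ← Equiv.sum_comp (Equiv.swap i k) fun α => -sqrtPotentialOp v α (φ α)]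
  refine Finset.sum_congr rfl fun α _ => ?_
  rw [permOp_sqrtPotentialOp, h i k hik, map_neg]

theorem birmanSchwingerMatrix_mem_faddeevSpace (v : PairInteraction) (z : ℝ) (hz : 0 < z)
    {φ : TripleL2} (h : φ ∈ faddeevSpace) : birmanSchwingerMatrix v z hz φ ∈ faddeevSpace := by
  rw [birmanSchwingerMatrix_apply]
  exact sqrtPotentialVec_mem_faddeevSpace v (resolvent_mem_antisymmetricSubspace
    (sqrtPotentialSum_mem_antisymmetricSubspace v h) z hz)

end Permutations

/-! ### Schrödinger operators with bounded potentials -/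

section Schrodinger

variable {E : Type*} [NormedAddCommGroup E] [InnerProductSpace ℝ E] [FiniteDimensional ℝ E]
  [MeasurableSpace E] [BorelSpace E]

theorem mem_domain_schrodinger_iff (W : L2 E →L[ℂ] L2 E) (S : Submodule ℂ (L2 E)) (x : L2 E) :
    x ∈ (schrodinger W S).domain ↔ x ∈ S ∧ x ∈ (negLaplacian E).domain := by
  refine Submodule.mem_inf.trans (and_congr_right fun _ => Submodule.mem_inf.trans ?_)
  exact and_iff_left (Submodule.mem_top)

/-- Every element of H² is the resolvent of some L² function, so symmetry of -Δ is inherited from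
the bounded resolvent. -/
theorem inner_negLaplacian_left (ψ χ : (negLaplacian E).domain) :
    inner ℂ (negLaplacian E ψ) (χ : L2 E) = inner ℂ (ψ : L2 E) (negLaplacian E χ) := by
  have h1 := resolvent_negLaplacian 1 one_pos ψ
  have h2 := resolvent_negLaplacian 1 one_pos χ
  have h3 := inner_resolvent_left 1 one_pos (negLaplacian E ψ + ((1 : ℝ) : ℂ) ^ 2 • (ψ : L2 E))
    (negLaplacian E χ + ((1 : ℝ) : ℂ) ^ 2 • (χ : L2 E))
  rw [h1, h2] at h3
  simpa [inner_add_left, inner_add_right] using h3.symm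

theorem re_inner_negLaplacian_nonneg (ψ : (negLaplacian E).domain) :
    0 ≤ (inner ℂ (ψ : L2 E) (negLaplacian E ψ)).re := by
  have h1 := resolvent_negLaplacian 1 one_pos ψ
  have h2 := sq_mul_norm_resolvent_sq_le 1 one_pos
    (negLaplacian E ψ + ((1 : ℝ) : ℂ) ^ 2 • (ψ : L2 E))
  rw [h1, inner_add_left, Complex.add_re, ← inner_conj_symm, Complex.conj_re, inner_smul_left,
    inner_self_eq_norm_sq_to_K] at h2
  norm_num at h2
  norm_cast at h2
  linarith

theorem mem_eigenspace_schrodinger_iff (W : L2 E →L[ℂ] L2 E) (S : Submodule ℂ (L2 E)) (e : ℝ)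
    (x : L2 E) : x ∈ eigenspace (schrodinger W S) e ↔
      x ∈ S ∧ ∃ h : x ∈ (negLaplacian E).domain,
        negLaplacian E ⟨x, h⟩ + W x = (e : ℂ) • x := by
  constructor
  · rintro ⟨h, h'⟩
    have h2 := (mem_domain_schrodinger_iff W S x).mp h
    exact ⟨h2.1, h2.2, h'⟩
  · rintro ⟨hS, h, h'⟩
    exact ⟨(mem_domain_schrodinger_iff W S x).mpr ⟨hS, h⟩, h'⟩

/-- `-Δ + W + w²` has a bounded inverse if `‖W‖ < w²`. -/
theorem exists_inverse_schrodinger (W : L2 E →L[ℂ] L2 E) (w : ℝ) (hw : 0 < w)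
    (hW : ‖W‖ < w ^ 2) :
    ∃ B : L2 E →L[ℂ] L2 E,
      (∀ η, ∃ h : B η ∈ (negLaplacian E).domain,
        negLaplacian E ⟨B η, h⟩ + W (B η) + (w : ℂ) ^ 2 • B η = η) ∧
      (∀ ψ : (negLaplacian E).domain,
        B (negLaplacian E ψ + W ψ + (w : ℂ) ^ 2 • (ψ : L2 E)) = ψ) := by
  set R := resolvent E w hw with hR
  -- Since -Δ + W + w² = (1 + WR)(-Δ + w²), a Neumann series for 1 + WR gives the inverse R(1 +
  -- WR)⁻¹.
  have hnorm : ‖-(W * R)‖ < 1 := by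
    rw [norm_neg]
    calc ‖W * R‖ ≤ ‖W‖ * ‖R‖ := norm_mul_le _ _
      _ ≤ ‖W‖ * (w ^ 2)⁻¹ := by gcongr; exact norm_resolvent_le w hw
      _ < w ^ 2 * (w ^ 2)⁻¹ := by gcongr
      _ = 1 := mul_inv_cancel₀ (by positivity)
  let u := Units.oneSub (-(W * R)) hnorm
  have hu : (u : L2 E →L[ℂ] L2 E) = 1 + W * R := by
    rw [Units.val_oneSub, sub_neg_eq_add]
  have h1 (η : L2 E) : (↑u⁻¹ : L2 E →L[ℂ] L2 E) η + W (R ((↑u⁻¹ : L2 E →L[ℂ] L2 E) η)) = η := by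
    have h := DFunLike.congr_fun (u.mul_inv) η
    rw [hu] at h
    exact h
  have h2 (η : L2 E) : (↑u⁻¹ : L2 E →L[ℂ] L2 E) (η + W (R η)) = η := by
    have h := DFunLike.congr_fun (u.inv_mul) η
    rw [hu] at h
    exact h
  refine ⟨R * ↑u⁻¹, fun η => ?_, fun ψ => ?_⟩
  · have h : (R * ↑u⁻¹) η ∈ (negLaplacian E).domain := resolvent_mem_sobolev2 w hw _
    refine ⟨h, ?_⟩
    have h3 := negLaplacian_resolvent w hw ((↑u⁻¹ : L2 E →L[ℂ] L2 E) η) h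
    have h4 : negLaplacian E ⟨(R * ↑u⁻¹) η, h⟩ = (↑u⁻¹ : L2 E →L[ℂ] L2 E) η -
      (w : ℂ) ^ 2 • (R * ↑u⁻¹) η := h3
    rw [h4]
    have h5 := h1 η
    change _ - _ + W (R ((↑u⁻¹ : L2 E →L[ℂ] L2 E) η)) + _ = _
    rw [sub_add_eq_add_sub, h5, sub_add_cancel]
  · have h3 := resolvent_negLaplacian w hw ψ
    have h4 := h2 (negLaplacian E ψ + (w : ℂ) ^ 2 • (ψ : L2 E))
    rw [← hR] at h3
    rw [h3] at h4
    change R ((↑u⁻¹ : L2 E →L[ℂ] L2 E) _) = _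
    rw [add_right_comm, h4, h3]

end Schrodinger

/-! ### The Birman–Schwinger principle -/

section BirmanSchwinger

variable {K K' : Type*} [NormedAddCommGroup K] [InnerProductSpace ℂ K]
  [NormedAddCommGroup K'] [InnerProductSpace ℂ K']

theorem finrank_map_eq_of_ne_zero (L : K →L[ℂ] K') (G : Submodule ℂ K)
    (hL : ∀ x ∈ G, x ≠ 0 → L x ≠ 0) :
    Module.finrank ℂ (G.map L.toLinearMap) = Module.finrank ℂ G := by
  rw [← LinearMap.range_domRestrict]
  apply LinearMap.finrank_range_of_inj
  rw [← LinearMap.ker_eq_bot, LinearMap.ker_eq_bot']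
  rintro ⟨x, hx⟩ h0
  by_contra hne
  exact hL x hx (fun h => hne (Subtype.ext h)) h0

/-- Transport of a positive subspace along an operator. -/
theorem IsPosOn.map {A' : K' →L[ℂ] K'} {G : Submodule ℂ K} (L : K →L[ℂ] K')
    (hL : ∀ x ∈ G, x ≠ 0 → 0 < (inner ℂ (L x) (A' (L x))).re) :
    IsPosOn A' (G.map L.toLinearMap) ∧
      Module.finrank ℂ (G.map L.toLinearMap) = Module.finrank ℂ G := by
  constructor
  · rintro _ ⟨x, hx, rfl⟩ hne
    refine hL x hx ?_
    rintro rfl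
    exact hne (map_zero _)
  · refine finrank_map_eq_of_ne_zero L G fun x hx hne h0 => ?_
    have h := hL x hx hne
    rw [h0, inner_zero_left] at h
    exact lt_irrefl _ h

theorem re_inner_self (x : K) : (inner ℂ x x : ℂ).re = ‖x‖ ^ 2 := by
  rw [inner_self_eq_norm_sq_to_K]
  norm_cast

theorem re_inner_comm (x y : K) : (inner ℂ x y : ℂ).re = (inner ℂ y x : ℂ).re := by
  rw [← inner_conj_symm, Complex.conj_re]

theorem birmanSchwingerMatrix_isSymmetric (v : PairInteraction) (z : ℝ) (hz : 0 < z)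
    (φ χ : TripleL2) : inner ℂ (birmanSchwingerMatrix v z hz φ) χ =
      inner ℂ φ (birmanSchwingerMatrix v z hz χ) := by
  rw [birmanSchwingerMatrix_apply, birmanSchwingerMatrix_apply, inner_sqrtPotentialVec_left,
    inner_resolvent_left, inner_sqrtPotentialSum_left]

theorem mem_eigenspace_birmanSchwinger_iff (v : PairInteraction) (z : ℝ) (hz : 0 < z) (e : ℝ)
    (φ : TripleL2) : φ ∈ eigenspace (birmanSchwinger v z hz) e ↔
      φ ∈ faddeevSpace ∧ birmanSchwingerMatrix v z hz φ = (e : ℂ) • φ :=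
  ⟨fun ⟨h, h'⟩ => ⟨h, h'⟩, fun ⟨h, h'⟩ => ⟨h, h'⟩⟩

theorem isSelfAdjoint_birmanSchwingerMatrix_sub_one (v : PairInteraction) (z : ℝ) (hz : 0 < z) :
    IsSelfAdjoint (birmanSchwingerMatrix v z hz - 1) :=
  (ContinuousLinearMap.isSelfAdjoint_iff_isSymmetric.mpr
    (birmanSchwingerMatrix_isSymmetric v z hz)).sub (IsSelfAdjoint.one _)

theorem re_inner_birmanSchwingerMatrix_sub_one (v : PairInteraction) (z : ℝ) (hz : 0 < z)
    (φ : TripleL2) : (inner ℂ φ ((birmanSchwingerMatrix v z hz - 1) φ)).re =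
      (inner ℂ φ (birmanSchwingerMatrix v z hz φ)).re - ‖φ‖ ^ 2 := by
  change (inner ℂ φ (birmanSchwingerMatrix v z hz φ - φ)).re = _
  rw [inner_sub_right, Complex.sub_re, re_inner_self]

/-- The number of eigenvalues of `M(z)` larger than `1` is the dimension of a spectral subspace,
provided that the subspaces on which `M(z) > 1` have bounded dimension. -/
theorem exists_spectral_subspace_birmanSchwinger (v : PairInteraction) (z : ℝ) (hz : 0 < z)
    (N : ℕ) (hN : ∀ W ≤ faddeevSpace, FiniteDimensional ℂ W →
      IsPosOn (birmanSchwingerMatrix v z hz - 1) W → Module.finrank ℂ W ≤ N) :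
    ∃ G ≤ faddeevSpace, IsPosOn (birmanSchwingerMatrix v z hz - 1) G ∧
      (∀ W ≤ faddeevSpace, IsPosOn (birmanSchwingerMatrix v z hz - 1) W →
        Module.finrank ℂ W ≤ Module.finrank ℂ G) ∧
      eigenvalueCount (birmanSchwinger v z hz) (Set.Ioi 1) = Module.finrank ℂ G := by
  have hinv : ∀ φ ∈ faddeevSpace, (birmanSchwingerMatrix v z hz - 1) φ ∈ faddeevSpace :=
    fun φ hφ => sub_mem (birmanSchwingerMatrix_mem_faddeevSpace v z hz hφ) hφ
  obtain ⟨G, hGF, hfin, hpos, heig, hneg, hcomm⟩ := exists_positive_spectral_subspace _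
    (isSelfAdjoint_birmanSchwingerMatrix_sub_one v z hz) faddeevSpace hinv N hN
  refine ⟨G, hGF, hpos, fun W hW hWpos => finrank_le_of_isPosOn hneg hW hWpos, ?_⟩
  refine eigenvalueCount_eq_finrank _ _ G (birmanSchwingerMatrix v z hz)
    (birmanSchwingerMatrix_isSymmetric v z hz)
    (hcomm _ ((Commute.refl _).sub_right (Commute.one_right _))
      fun φ hφ => birmanSchwingerMatrix_mem_faddeevSpace v z hz hφ)
    id (Set.injOn_id _) ?_ ?_ ?_
  · intro e he φ hφ
    rw [mem_eigenspace_birmanSchwinger_iff] at hφ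
    refine heig φ hφ.1 (e - 1) (sub_pos.mpr he) ?_
    change birmanSchwingerMatrix v z hz φ - φ = _
    rw [hφ.2, Complex.ofReal_sub, sub_smul, Complex.ofReal_one, one_smul]
  · intro e _ φ hφ
    exact ((mem_eigenspace_birmanSchwinger_iff v z hz e φ).mp hφ).2
  · intro φ hφ hne b hb
    refine ⟨b, ?_, (mem_eigenspace_birmanSchwinger_iff v z hz b φ).mpr ⟨hGF hφ, hb⟩⟩
    have h := hpos φ hφ hne
    rw [re_inner_birmanSchwingerMatrix_sub_one, hb, inner_smul_right, Complex.re_ofReal_mul,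
      re_inner_self] at h
    have h2 : 0 < ‖φ‖ ^ 2 := by positivity
    change 1 < b
    by_contra hb1
    nlinarith

/-- The abstract Birman–Schwinger principle. Here `R = P₀⁻¹` and `B = (P₀ - V + c)⁻¹` with
`V = T† T`; the positive subspaces of `c B² - B` correspond to those of `T R T† - 1`. -/
theorem IsPosOn.exists_finrank_eq_of_resolvent [CompleteSpace K] {R B : K →L[ℂ] K} {T : K →L[ℂ] K'}
    {T' : K' →L[ℂ] K} {M : K' →L[ℂ] K'} {c : ℝ} (hRnonneg : 0 ≤ R)
    (hTT' : ∀ x y, inner ℂ (T x) y = inner ℂ x (T' y))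
    (hMapp : ∀ φ, M φ = T (R (T' φ)))
    (hBsym : ∀ x y, inner ℂ (B x) y = inner ℂ x (B y))
    (hRB : ∀ ζ, B (ζ - T' (T (R ζ)) + (c : ℂ) • R ζ) = R ζ)
    (hBR : ∀ η, B η = R (η + T' (T (B η)) - (c : ℂ) • B η))
    {S : Submodule ℂ K} {F : Submodule ℂ K'} (hRS : ∀ x ∈ S, R x ∈ S) (hBS : ∀ x ∈ S, B x ∈ S)
    (hTS : ∀ x ∈ S, T x ∈ F) (hTF : ∀ φ ∈ F, T' φ ∈ S) :
    (∀ W ≤ F, IsPosOn (M - 1) W → ∃ W' ≤ S, IsPosOn ((c : ℂ) • (B * B) - B) W' ∧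
      Module.finrank ℂ W' = Module.finrank ℂ W) ∧
    (∀ W ≤ S, FiniteDimensional ℂ W → IsPosOn ((c : ℂ) • (B * B) - B) W →
      ∃ W' ≤ F, FiniteDimensional ℂ W' ∧ IsPosOn (M - 1) W' ∧
        Module.finrank ℂ W' = Module.finrank ℂ W) := by
  have hT'T (φ : K') (x : K) : inner ℂ (T' φ) x = inner ℂ φ (T x) := by
    rw [← inner_conj_symm, ← hTT', inner_conj_symm]
  have hVsym (x y : K) : inner ℂ (T' (T x)) y = inner ℂ x (T' (T y)) := by
    rw [hT'T, hTT']
  have hVnorm (x : K) : (inner ℂ x (T' (T x))).re = ‖T x‖ ^ 2 := by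
    rw [← hTT', re_inner_self]
  have hAinner (x : K) : (inner ℂ x (((c : ℂ) • (B * B) - B) x)).re =
      c * ‖B x‖ ^ 2 - (inner ℂ x (B x)).re := by
    change (inner ℂ x ((c : ℂ) • B (B x) - B x)).re = _
    rw [inner_sub_right, inner_smul_right, ← hBsym, Complex.sub_re, Complex.re_ofReal_mul,
      re_inner_self]
  have hM1 (φ : K') : (inner ℂ φ ((M - 1) φ)).re = (inner ℂ φ (M φ)).re - ‖φ‖ ^ 2 := by
    change (inner ℂ φ (M φ - φ)).re = _
    rw [inner_sub_right, Complex.sub_re, re_inner_self]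
  have hMinner (φ : K') : (inner ℂ φ (M φ)).re = (inner ℂ (T' φ) (R (T' φ))).re := by
    rw [hMapp, hT'T]
  constructor
  · intro W hW hWpos
    -- L = (P₀ - V + c) R T', chosen so that B L = R T'.
    let L : K' →L[ℂ] K := (1 - (T' ∘L T) ∘L R + (c : ℂ) • R) ∘L T'
    have hLapp (φ : K') : L φ = T' φ - T' (T (R (T' φ))) + (c : ℂ) • R (T' φ) := rfl
    have hL (φ : K') (hφ : 0 < (inner ℂ φ ((M - 1) φ)).re) :
        0 < (inner ℂ (L φ) (((c : ℂ) • (B * B) - B) (L φ))).re := by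
      rw [hM1] at hφ
      have h1 : B (L φ) = R (T' φ) := hRB (T' φ)
      have h2 : (inner ℂ (L φ) (((c : ℂ) • (B * B) - B) (L φ))).re =
          ‖M φ‖ ^ 2 - (inner ℂ φ (M φ)).re := by
        rw [hAinner, h1, hLapp, inner_add_left, inner_sub_left, inner_smul_left, Complex.add_re,
          Complex.sub_re, Complex.conj_ofReal, Complex.re_ofReal_mul, re_inner_self, hVsym, hVnorm,
          ← hMapp, ← hMinner]
        ring
      rw [h2]
      -- From ‖φ‖² < ⟨φ, Mφ⟩ ≤ ‖φ‖‖Mφ‖ follows ‖φ‖ < ‖Mφ‖, hence ⟨φ, Mφ⟩ < ‖Mφ‖².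
      have h3 := (Complex.re_le_norm _).trans (norm_inner_le_norm (𝕜 := ℂ) φ (M φ))
      have h4 := norm_nonneg φ
      have h5 := norm_nonneg (M φ)
      by_contra h6
      nlinarith
    refine ⟨W.map L.toLinearMap, Submodule.map_le_iff_le_comap.mpr fun φ hφ => ?_,
      IsPosOn.map L fun φ hφ hne => hL φ (hWpos φ hφ hne)⟩
    have h1 := hTF φ (hW hφ)
    have h2 := hRS _ h1
    exact add_mem (sub_mem h1 (hTF _ (hTS _ h2))) (Submodule.smul_mem _ _ h2)
  · intro W hW hWfin hWpos
    let Q : K →L[ℂ] K' := T ∘L B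
    have hQapp (η : K) : Q η = T (B η) := rfl
    have hQ (η : K) (hη : 0 < (inner ℂ η (((c : ℂ) • (B * B) - B) η)).re) :
        0 < (inner ℂ (Q η) ((M - 1) (Q η))).re := by
      rw [hM1, hMinner, hQapp]
      rw [hAinner] at hη
      set ψ := B η with hψ
      -- ζ = P₀ψ, read off from (P₀ - V + c)ψ = η. Positivity at η becomes ⟨ψ, P₀ψ⟩ < ‖Tψ‖².
      set ζ := η + T' (T ψ) - (c : ℂ) • ψ with hζ
      have h1 : ψ = R ζ := hBR η
      have h2 : (inner ℂ ζ ψ).re = (inner ℂ η ψ).re + ‖T ψ‖ ^ 2 - c * ‖ψ‖ ^ 2 := by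
        rw [hζ, inner_sub_left, inner_add_left, inner_smul_left, Complex.sub_re, Complex.add_re,
          Complex.conj_ofReal, Complex.re_ofReal_mul, re_inner_self, hVsym, hVnorm]
      -- Cauchy–Schwarz for the form of R: ‖Tψ‖⁴ = ⟨T'Tψ, Rζ⟩² ≤ ⟨Tψ, M Tψ⟩⟨ζ, ψ⟩. With ⟨ζ, ψ⟩ <
      -- ‖Tψ‖² this forces ⟨Tψ, M Tψ⟩ > ‖Tψ‖².
      have h3 := sq_re_inner_le hRnonneg (T' (T ψ)) ζ
      rw [← h1, re_inner_comm, hVnorm] at h3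
      have h4 : (inner ℂ ζ ψ).re < ‖T ψ‖ ^ 2 := by linarith
      have h5 : 0 ≤ (inner ℂ ζ ψ).re := by
        rw [h1]
        exact ((ContinuousLinearMap.nonneg_iff_isPositive R).mp hRnonneg).re_inner_nonneg_right ζ
      by_contra h6
      have h7 : 0 < ‖T ψ‖ ^ 2 := lt_of_le_of_lt h5 h4
      have h8 : (inner ℂ (T' (T ψ)) (R (T' (T ψ)))).re ≤ ‖T ψ‖ ^ 2 := by linarith
      have h9 : (inner ℂ (T' (T ψ)) (R (T' (T ψ)))).re * (inner ℂ ζ ψ).re ≤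
          ‖T ψ‖ ^ 2 * (inner ℂ ζ ψ).re := mul_le_mul_of_nonneg_right h8 h5
      nlinarith
    exact ⟨W.map Q.toLinearMap, Submodule.map_le_iff_le_comap.mpr fun η hη =>
      hTS _ (hBS _ (hW hη)), inferInstance, IsPosOn.map Q fun η hη hne => hQ η (hWpos η hη hne)⟩

/-- The operator `ψ ↦ ∑_α |v_α| ψ`. -/
noncomputable def absPotentialOp (v : PairInteraction) : L2 Config →L[ℂ] L2 Config :=
  sqrtPotentialSum v ∘L sqrtPotentialVec v

theorem absPotentialOp_apply (v : PairInteraction) (x : L2 Config) :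
    absPotentialOp v x = sqrtPotentialSum v (sqrtPotentialVec v x) := rfl

theorem permOp_absPotentialOp (v : PairInteraction) (p : Equiv.Perm (Fin 3)) (x : L2 Config) :
    permOp p (absPotentialOp v x) = absPotentialOp v (permOp p x) := by
  rw [absPotentialOp_apply, absPotentialOp_apply, sqrtPotentialSum_apply, sqrtPotentialSum_apply,
    map_sum, ← Equiv.sum_comp p fun α => sqrtPotentialOp v α (sqrtPotentialVec v (permOp p x) α)]
  refine Finset.sum_congr rfl fun α _ => ?_
  rw [sqrtPotentialVec_apply, sqrtPotentialVec_apply, permOp_sqrtPotentialOp,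
    permOp_sqrtPotentialOp]

theorem inner_absPotentialOp_left (v : PairInteraction) (x y : L2 Config) :
    inner ℂ (absPotentialOp v x) y = inner ℂ x (absPotentialOp v y) := by
  rw [absPotentialOp_apply, absPotentialOp_apply, inner_sqrtPotentialSum_left,
    inner_sqrtPotentialVec_left]

/-- For `w` large, `B = (H₀ + ∑ v_α + w²)⁻¹` exists as a bounded operator on `L²(ℝ⁴)`. -/
structure IsHamiltonianInverse (v : PairInteraction) (w : ℝ) (B : L2 Config →L[ℂ] L2 Config) :
    Prop where
  right_inv : ∀ η, ∃ h : B η ∈ (negLaplacian Config).domain,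
    negLaplacian Config ⟨B η, h⟩ - absPotentialOp v (B η) + (w : ℂ) ^ 2 • B η = η
  left_inv : ∀ (ψ : L2 Config) (h : ψ ∈ (negLaplacian Config).domain),
    B (negLaplacian Config ⟨ψ, h⟩ - absPotentialOp v ψ + (w : ℂ) ^ 2 • ψ) = ψ

theorem exists_isHamiltonianInverse (v : PairInteraction) (w : ℝ) (hw : 0 < w)
    (hwV : ‖absPotentialOp v‖ < w ^ 2) : ∃ B, IsHamiltonianInverse v w B := by
  obtain ⟨B, hB1, hB2⟩ := exists_inverse_schrodinger (-absPotentialOp v) w hw (by rwa [norm_neg])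
  refine ⟨B, fun η => ?_, fun ψ h => ?_⟩
  · obtain ⟨h, h1⟩ := hB1 η
    refine ⟨h, ?_⟩
    rw [sub_eq_add_neg]
    exact h1
  · rw [sub_eq_add_neg]
    exact hB2 ⟨ψ, h⟩

namespace IsHamiltonianInverse

variable {v : PairInteraction} {w : ℝ} {B : L2 Config →L[ℂ] L2 Config}

/-- With ψ = Bη, (H₀ + z²)ψ = η + Vψ - (w² - z²)ψ. This and `apply_eq_resolvent` link B, taken at w,
to the resolvent at z. -/
theorem eq_resolvent (hB : IsHamiltonianInverse v w B) {z : ℝ} (hz : 0 < z) (η : L2 Config) :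
    B η = resolvent Config z hz
      (η + absPotentialOp v (B η) - ((w ^ 2 - z ^ 2 : ℝ) : ℂ) • B η) := by
  obtain ⟨h, h1⟩ := hB.right_inv η
  have h2 := resolvent_negLaplacian z hz ⟨B η, h⟩
  refine h2.symm.trans (congrArg _ ?_)
  conv_rhs => rw [← h1]
  change negLaplacian Config ⟨B η, h⟩ + (z : ℂ) ^ 2 • B η = _
  rw [Complex.ofReal_sub, sub_smul, Complex.ofReal_pow, Complex.ofReal_pow, h1]
  conv_rhs => enter [1, 1]; rw [← h1]
  abel

theorem apply_eq_resolvent (hB : IsHamiltonianInverse v w B) {z : ℝ} (hz : 0 < z)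
    (ζ : L2 Config) :
    B (ζ - absPotentialOp v (resolvent Config z hz ζ) +
      ((w ^ 2 - z ^ 2 : ℝ) : ℂ) • resolvent Config z hz ζ) = resolvent Config z hz ζ := by
  have h : resolvent Config z hz ζ ∈ (negLaplacian Config).domain := resolvent_mem_sobolev2 z hz ζ
  have h1 := hB.left_inv _ h
  refine Eq.trans (congrArg _ ?_) h1
  rw [negLaplacian_resolvent z hz ζ h, Complex.ofReal_sub, sub_smul, Complex.ofReal_pow,
    Complex.ofReal_pow]
  abel

theorem isSymmetric (hB : IsHamiltonianInverse v w B) (x y : L2 Config) :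
    inner ℂ (B x) y = inner ℂ x (B y) := by
  obtain ⟨hx, h1⟩ := hB.right_inv x
  obtain ⟨hy, h2⟩ := hB.right_inv y
  have h3 : inner ℂ (negLaplacian Config ⟨B x, hx⟩) (B y) =
      inner ℂ (B x) (negLaplacian Config ⟨B y, hy⟩) :=
    inner_negLaplacian_left ⟨B x, hx⟩ ⟨B y, hy⟩
  have h4 := inner_absPotentialOp_left v (B x) (B y)
  have h5 : inner ℂ (B x) (negLaplacian Config ⟨B y, hy⟩ - absPotentialOp v (B y) +
      (w : ℂ) ^ 2 • B y) = inner ℂ (negLaplacian Config ⟨B x, hx⟩ - absPotentialOp v (B x) +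
      (w : ℂ) ^ 2 • B x) (B y) := by
    rw [inner_add_left, inner_sub_left, inner_add_right, inner_sub_right, inner_smul_left,
      inner_smul_right, h3, h4, map_pow, Complex.conj_ofReal]
  rwa [h1, h2] at h5

/-- With ψ = Bx the form is ⟨ψ, (H + w²)ψ⟩, and w² dominates ‖V‖. -/
theorem re_inner_nonneg (hB : IsHamiltonianInverse v w B) (hw : ‖absPotentialOp v‖ < w ^ 2)
    (x : L2 Config) : 0 ≤ (inner ℂ x (B x)).re := by
  obtain ⟨hx, h1⟩ := hB.right_inv x
  have h2 : 0 ≤ (inner ℂ (B x) (negLaplacian Config ⟨B x, hx⟩)).re :=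
    re_inner_negLaplacian_nonneg ⟨B x, hx⟩
  have h3 : ‖(inner ℂ (B x) (absPotentialOp v (B x)) : ℂ)‖ ≤ w ^ 2 * ‖B x‖ ^ 2 :=
    calc _ ≤ ‖B x‖ * ‖absPotentialOp v (B x)‖ := norm_inner_le_norm _ _
      _ ≤ ‖B x‖ * (‖absPotentialOp v‖ * ‖B x‖) := by
        gcongr
        exact (absPotentialOp v).le_opNorm _
      _ = ‖absPotentialOp v‖ * ‖B x‖ ^ 2 := by ring
      _ ≤ _ := by gcongr
  have h4 := (Complex.re_le_norm _).trans h3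
  have h5 : 0 ≤ (inner ℂ (B x) (negLaplacian Config ⟨B x, hx⟩ - absPotentialOp v (B x) +
      (w : ℂ) ^ 2 • B x)).re := by
    rw [inner_add_right, inner_sub_right, inner_smul_right, Complex.add_re, Complex.sub_re,
      ← Complex.ofReal_pow, Complex.re_ofReal_mul, re_inner_self]
    linarith
  rwa [h1, re_inner_comm] at h5

theorem mem_antisymmetricSubspace (hB : IsHamiltonianInverse v w B) {x : L2 Config}
    (hx : x ∈ antisymmetricSubspace) : B x ∈ antisymmetricSubspace := by
  intro p
  have h1 := hB.eq_resolvent one_pos x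
  have h0 := hB.apply_eq_resolvent one_pos
  set R := resolvent Config 1 one_pos with hR
  set c : ℂ := ((w ^ 2 - 1 ^ 2 : ℝ) : ℂ)
  -- ζ = (H₀ + 1)Bx, so x = (H + w²)Rζ is written with operators that commute with p. Applying p and
  -- then B shows that B commutes with p at x.
  set ζ := x + absPotentialOp v (B x) - c • B x with hζ
  have h2 : x = ζ - absPotentialOp v (R ζ) + c • R ζ := by
    rw [← h1, hζ]
    abel
  have h3 : permOp p x =
      permOp p ζ - absPotentialOp v (R (permOp p ζ)) + c • R (permOp p ζ) := by
    conv_lhs => rw [h2]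
    rw [map_add, map_sub, permOp_absPotentialOp, map_smul, hR, permOp_resolvent]
  rw [h1, hR, permOp_resolvent, ← hR, ← h0, ← h3, hx p, map_smul, h1]

theorem mem_eigenspace_hamiltonian_iff (e : ℝ) (x : L2 Config) :
    x ∈ eigenspace (hamiltonian v) e ↔ x ∈ antisymmetricSubspace ∧
      ∃ h : x ∈ (negLaplacian Config).domain,
        negLaplacian Config ⟨x, h⟩ - absPotentialOp v x = (e : ℂ) • x := by
  refine (mem_eigenspace_schrodinger_iff _ _ e x).trans ?_
  rw [sum_potentialOp_eq]
  simp only [← absPotentialOp_apply, ← sub_eq_add_neg]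

theorem eq_smul_of_mem_eigenspace (hB : IsHamiltonianInverse v w B) {e : ℝ} {x : L2 Config}
    (hx : x ∈ eigenspace (hamiltonian v) e) : x = ((e + w ^ 2 : ℝ) : ℂ) • B x := by
  obtain ⟨-, h, h'⟩ := (mem_eigenspace_hamiltonian_iff e x).mp hx
  have h2 := hB.left_inv x h
  rw [h', ← add_smul, map_smul] at h2
  conv_lhs => rw [← h2]
  push_cast
  rfl

theorem apply_of_mem_eigenspace (hB : IsHamiltonianInverse v w B) {e : ℝ} {x : L2 Config}
    (hx : x ∈ eigenspace (hamiltonian v) e) : B x = (((e + w ^ 2)⁻¹ : ℝ) : ℂ) • x := by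
  have h1 := hB.eq_smul_of_mem_eigenspace hx
  -- At e = -w² the inverse takes the default value 0; the eigenspace is trivial there because x =
  -- (e + w²)Bx.
  rcases eq_or_ne (e + w ^ 2) 0 with h0 | h0
  · have hx0 : x = 0 := by rw [h1, h0, Complex.ofReal_zero, zero_smul]
    rw [hx0, map_zero, smul_zero]
  · conv_rhs => rw [h1]
    rw [smul_smul, ← Complex.ofReal_mul, inv_mul_cancel₀ h0, Complex.ofReal_one, one_smul]

theorem mem_eigenspace_of_apply (hB : IsHamiltonianInverse v w B) {b : ℝ} (hb0 : b ≠ 0)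
    {x : L2 Config} (hxS : x ∈ antisymmetricSubspace) (hb : B x = (b : ℂ) • x) :
    x ∈ eigenspace (hamiltonian v) (b⁻¹ - w ^ 2) := by
  refine (mem_eigenspace_hamiltonian_iff _ x).mpr ⟨hxS, ?_⟩
  have hbC : (b : ℂ) ≠ 0 := by exact_mod_cast hb0
  obtain ⟨h4, h5⟩ := hB.right_inv ((b⁻¹ : ℂ) • x)
  have h6 : B ((b⁻¹ : ℂ) • x) = x := by
    rw [map_smul, hb, smul_smul, inv_mul_cancel₀ hbC, one_smul]
  simp only [h6] at h4 h5
  refine ⟨h4, ?_⟩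
  rw [Complex.ofReal_sub, sub_smul, Complex.ofReal_inv, ← h5, Complex.ofReal_pow]
  abel

/-- The number of bound states of `H` below `-z²` is the dimension of a spectral subspace of
`B = (H + w²)⁻¹`, where `c = w² - z²`. -/
theorem boundStateCount_eq_finrank (hB : IsHamiltonianInverse v w B)
    (hw : ‖absPotentialOp v‖ < w ^ 2) {z c : ℝ} (hc : c = w ^ 2 - z ^ 2)
    {G : Submodule ℂ (L2 Config)}
    [FiniteDimensional ℂ G] (hGS : G ≤ antisymmetricSubspace)
    (hpos : IsPosOn ((c : ℂ) • (B * B) - B) G)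
    (heig : ∀ x ∈ antisymmetricSubspace, ∀ μ : ℝ, 0 < μ →
      ((c : ℂ) • (B * B) - B) x = (μ : ℂ) • x → x ∈ G)
    (hBG : ∀ x ∈ G, B x ∈ G) : boundStateCount v z = Module.finrank ℂ G := by
  refine eigenvalueCount_eq_finrank _ _ G B hB.isSymmetric hBG (fun e => (e + w ^ 2)⁻¹)
    (fun e _ e' _ h => add_right_cancel (inv_injective h)) ?_
    (fun e _ x hx => hB.apply_of_mem_eigenspace hx) ?_
  · intro e he x hx
    have h1 := hB.apply_of_mem_eigenspace hx
    rcases eq_or_ne (e + w ^ 2) 0 with h0 | h0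
    · have hx0 : x = 0 := by
        rw [hB.eq_smul_of_mem_eigenspace hx, h0, Complex.ofReal_zero, zero_smul]
      rw [hx0]
      exact zero_mem _
    · refine heig x ((mem_eigenspace_hamiltonian_iff e x).mp hx).1
        -- With b = (e + w²)⁻¹, cb² - b = b²(c - e - w²) = b²(-z² - e).
        (((e + w ^ 2)⁻¹) ^ 2 * (-z ^ 2 - e)) ?_ ?_
      · have : e < -z ^ 2 := he
        have h2 : 0 < -z ^ 2 - e := by linarith
        positivity
      · change (c : ℂ) • B (B x) - B x = _
        rw [h1, map_smul, h1, smul_smul, smul_smul, ← sub_smul, ← Complex.ofReal_mul,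
          ← Complex.ofReal_mul, ← Complex.ofReal_sub]
        congr 2
        rw [hc]
        field_simp
        ring
  · intro x hx hne b hb
    have h1 := hpos x hx hne
    have h2 := hB.re_inner_nonneg hw x
    have h0 : ((c : ℂ) • (B * B) - B) x = ((c * b ^ 2 - b : ℝ) : ℂ) • x := by
      change (c : ℂ) • B (B x) - B x = _
      rw [hb, map_smul, hb, smul_smul, smul_smul, ← sub_smul]
      congr 1
      push_cast
      ring
    rw [h0, inner_smul_right, Complex.re_ofReal_mul, re_inner_self] at h1
    rw [hb, inner_smul_right, Complex.re_ofReal_mul, re_inner_self] at h2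
    have h3 : 0 < ‖x‖ ^ 2 := by positivity
    have h4 : 0 < c * b ^ 2 - b := (pos_iff_pos_of_mul_pos h1).mpr h3
    have hb0 : 0 < b := by
      refine lt_of_le_of_ne (nonneg_of_mul_nonneg_left h2 h3) fun h => ?_
      rw [← h] at h4
      norm_num at h4
    -- From cb² > b > 0 one gets b⁻¹ < c, that is, the energy b⁻¹ - w² lies below -z².
    have hcb : 1 < c * b := by nlinarith
    refine ⟨b⁻¹ - w ^ 2, ?_, hB.mem_eigenspace_of_apply hb0.ne' (hGS hx) hb⟩
    change b⁻¹ - w ^ 2 < -z ^ 2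
    have : b⁻¹ < c := by rwa [inv_lt_iff_one_lt_mul₀ hb0]
    linarith

end IsHamiltonianInverse

/-- The Birman–Schwinger principle, provided that the subspaces on which `M(z) > 1` have bounded
dimension. -/
theorem boundStateCount_eq_of_finite (v : PairInteraction) (z : ℝ) (hz : 0 < z)
    (N : ℕ) (hN : ∀ W ≤ faddeevSpace, FiniteDimensional ℂ W →
      IsPosOn (birmanSchwingerMatrix v z hz - 1) W → Module.finrank ℂ W ≤ N) :
    boundStateCount v z = eigenvalueCount (birmanSchwinger v z hz) (Set.Ioi 1) := by
  obtain ⟨w, hw, hwV⟩ : ∃ w : ℝ, 0 < w ∧ ‖absPotentialOp v‖ < w ^ 2 := by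
    refine ⟨Real.sqrt (‖absPotentialOp v‖ + 1), by positivity, ?_⟩
    rw [Real.sq_sqrt (by positivity)]
    linarith
  obtain ⟨B, hB⟩ := exists_isHamiltonianInverse v w hw hwV
  -- w depends on v alone, so c may be negative; the argument does not use its sign.
  obtain ⟨c, hc⟩ : ∃ c : ℝ, c = w ^ 2 - z ^ 2 := ⟨_, rfl⟩
  obtain ⟨GM, hGMF, hGMpos, hGMmax, hGMcount⟩ :=
    exists_spectral_subspace_birmanSchwinger v z hz N hN
  obtain ⟨hup, hdown⟩ := IsPosOn.exists_finrank_eq_of_resolvent (c := c)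
    (resolvent_nonneg (E := Config) z hz)
    (inner_sqrtPotentialVec_left v) (birmanSchwingerMatrix_apply v z hz) hB.isSymmetric
    (hc ▸ hB.apply_eq_resolvent hz) (hc ▸ hB.eq_resolvent hz)
    (S := antisymmetricSubspace) (F := faddeevSpace)
    (fun x hx => resolvent_mem_antisymmetricSubspace hx z hz)
    (fun x hx => hB.mem_antisymmetricSubspace hx)
    (fun x hx => sqrtPotentialVec_mem_faddeevSpace v hx)
    (fun φ hφ => sqrtPotentialSum_mem_antisymmetricSubspace v hφ)
  have hBself : IsSelfAdjoint B :=
    ContinuousLinearMap.isSelfAdjoint_iff_isSymmetric.mpr hB.isSymmetric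
  have hAself : IsSelfAdjoint ((c : ℂ) • (B * B) - B) := by
    refine (IsSelfAdjoint.smul (Complex.conj_ofReal c) ?_).sub hBself
    rw [isSelfAdjoint_iff, star_mul, hBself.star_eq]
  obtain ⟨G, hGS, hfin, hpos, heig, hneg, hcomm⟩ := exists_positive_spectral_subspace _ hAself
    antisymmetricSubspace
    (fun x hx => sub_mem (Submodule.smul_mem _ _ (hB.mem_antisymmetricSubspace
      (hB.mem_antisymmetricSubspace hx))) (hB.mem_antisymmetricSubspace hx)) N
    -- The bound on positive subspaces of M - 1 passes to those of cB² - B by transport.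
    (fun W hW hWfin hWpos => by
      obtain ⟨W', h1, h2, h3, h4⟩ := hdown W hW hWfin hWpos
      exact h4 ▸ hN W' h1 h2 h3)
  rw [hGMcount, hB.boundStateCount_eq_finrank hwV hc hGS hpos heig
    (hcomm B ((((Commute.refl B).mul_right (Commute.refl B)).smul_right _).sub_right
      (Commute.refl B)) fun x hx => hB.mem_antisymmetricSubspace hx), Nat.cast_inj]
  apply le_antisymm
  · obtain ⟨W', h1, h2, h3, h4⟩ := hdown G hGS hfin hpos
    exact h4 ▸ hGMmax W' h1 h3
  · obtain ⟨W', h1, h2, h3⟩ := hup GM hGMF hGMpos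
    exact h3 ▸ finrank_le_of_isPosOn hneg h1 h2

end BirmanSchwinger

/-! ### Convolution kernels and Hilbert–Schmidt bounds -/

section Kernel

/-- The function `ξ ↦ conj (exp (2πi⟨ξ, X⟩) g ξ)`. -/
noncomputable def modulate {E : Type*} [NormedAddCommGroup E] [InnerProductSpace ℝ E] (g : E → ℂ)
    (X ξ : E) : ℂ :=
  starRingEnd ℂ ((Real.fourierChar (inner ℝ ξ X) : ℂ) * g ξ)

theorem norm_modulate {E : Type*} [NormedAddCommGroup E] [InnerProductSpace ℝ E] (g : E → ℂ)
    (X ξ : E) : ‖modulate g X ξ‖ = ‖g ξ‖ := by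
  rw [modulate, RCLike.norm_conj, norm_mul, Circle.norm_coe, one_mul]

variable {E : Type*} [NormedAddCommGroup E] [InnerProductSpace ℝ E] [FiniteDimensional ℝ E]
  [MeasurableSpace E] [BorelSpace E]

theorem continuous_fourierInv {f : E → ℂ} (hf : Integrable f) : Continuous (𝓕⁻ f : E → ℂ) :=
  VectorFourier.fourierIntegral_continuous (L := -innerₗ E) Real.continuous_fourierChar
    (by
      simp only [LinearMap.neg_apply, innerₗ_apply_apply]
      fun_prop) hf

/-- On `L¹ ∩ L²` the inverse Fourier transform of `L²` is given by the integral. -/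
theorem coeFn_fourierInv (G : L2 E) (hG : Integrable G) :
    (𝓕⁻ G : L2 E) =ᵐ[volume] (𝓕⁻ (G : E → ℂ) : E → ℂ) := by
  refine ae_eq_of_integral_contDiff_smul_eq
    ((Lp.memLp (𝓕⁻ G : L2 E)).locallyIntegrable (by norm_num))
    (continuous_fourierInv hG).locallyIntegrable fun g hg hgc => ?_
  have hg₁ : HasCompactSupport (Complex.ofRealCLM ∘ g) := hgc.comp_left rfl
  have hg₂ : ContDiff ℝ (⊤ : ℕ∞) (Complex.ofRealCLM ∘ g) :=
    Complex.ofRealCLM.contDiff.comp hg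
  set u : 𝓢(E, ℂ) := hg₁.toSchwartzMap hg₂ with hu
  have hux (x : E) : u x = (g x : ℂ) := rfl
  have h1 : ∫ x, g x • (𝓕⁻ G : L2 E) x = Lp.toTemperedDistribution (𝓕⁻ G : L2 E) u := by
    rw [Lp.toTemperedDistribution_apply]
    refine integral_congr_ae (.of_forall fun x => ?_)
    simp only [hux, Complex.real_smul, smul_eq_mul]
  rw [h1, ← Lp.fourierInv_toTemperedDistribution_eq, TemperedDistribution.fourierInv_apply,
    Lp.toTemperedDistribution_apply]
  -- The distributional and the integral transform have the same pairing with test functions, by the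
  -- multiplication formula ∫ û G = ∫ u Ĝ.
  have h2 := VectorFourier.integral_fourierIntegral_smul_eq_flip (e := Real.fourierChar)
    (μ := (volume : Measure E)) (ν := (volume : Measure E)) (L := -innerₗ E) (f := u)
    (g := (G : E → ℂ)) Real.continuous_fourierChar (by
      simp only [LinearMap.neg_apply, innerₗ_apply_apply]
      fun_prop) u.integrable hG
  have hflip : (-innerₗ E).flip = -innerₗ E := by
    ext x y
    simp [real_inner_comm]
  rw [hflip] at h2
  refine Eq.trans ?_ (h2.trans ?_)
  · rw [SchwartzMap.fourierInv_coe]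
    rfl
  · refine integral_congr_ae (.of_forall fun x => ?_)
    simp only [hux, Complex.real_smul, smul_eq_mul]
    rfl

theorem memLp_modulate {g : E → ℂ} {p : ℝ≥0∞} (hg : MemLp g p volume) (X : E) :
    MemLp (modulate g X) p volume := by
  refine hg.of_le ?_ (.of_forall fun ξ => (norm_modulate g X ξ).le)
  refine Complex.continuous_conj.comp_aestronglyMeasurable
    (AEStronglyMeasurable.mul (Continuous.aestronglyMeasurable ?_) hg.1)
  fun_prop

theorem fourierInv_modulate (g : E → ℂ) (X U : E) :
    (𝓕⁻ (modulate g X) : E → ℂ) U = (𝓕⁻ (modulate g 0) : E → ℂ) (U - X) := by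
  rw [Real.fourierInv_eq, Real.fourierInv_eq]
  congr 1
  ext ξ
  simp only [modulate, inner_zero_right, inner_sub_right, Circle.smul_def, smul_eq_mul, map_mul,
    AddChar.map_zero_eq_one, Circle.coe_one, one_mul, AddChar.map_sub_eq_div, Circle.coe_div]
  rw [div_eq_mul_inv, ← Circle.coe_inv, Circle.coe_inv_eq_conj]
  ring

/-- The convolution kernel of the Fourier multiplier `g(p)` at `X`, as an element of `L²`. -/
noncomputable def multiplierKernel {g : E → ℂ} (hg : MemLp g 2 volume) (X : E) : L2 E :=
  𝓕⁻ ((memLp_modulate hg X).toLp : L2 E)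

theorem coeFn_multiplierKernel {g : E → ℂ} (hg : MemLp g 2 volume) (hg1 : Integrable g) (X : E) :
    multiplierKernel hg X =ᵐ[volume] fun U => (𝓕⁻ (modulate g 0) : E → ℂ) (U - X) := by
  have h1 := (memLp_modulate hg X).coeFn_toLp
  have hint : Integrable (modulate g X) :=
    memLp_one_iff_integrable.mp (memLp_modulate (memLp_one_iff_integrable.mpr hg1) X)
  filter_upwards [coeFn_fourierInv ((memLp_modulate hg X).toLp : L2 E) (hint.congr h1.symm)]
    with U hU
  rw [multiplierKernel, hU, Real.fourierInv_congr_ae h1, fourierInv_modulate]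

/-- At X the value is ∫ exp(2πi⟨ξ, X⟩) g(ξ) ĥ(ξ) dξ, an inner product in ĥ; Plancherel moves it to
h. This pointwise form is what Bessel's inequality is applied to. -/
theorem coeFn_fourierMulOp {g : E → ℂ} (hgt : MemLp g ∞ volume) (hg : MemLp g 2 volume)
    (h : L2 E) :
    fourierMulOp g hgt h =ᵐ[volume] fun X => inner ℂ (multiplierKernel hg X) h := by
  have h1 : (fourierMulOp g hgt h : L2 E) = 𝓕⁻ (mulOp g hgt (𝓕 h)) := by
    rw [← fourier_fourierMulOp, FourierTransform.fourierInv_fourier_eq]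
  have h2 := coeFn_mulOp hgt (𝓕 h)
  have hint : Integrable (fun ξ => g ξ * (𝓕 h : L2 E) ξ) :=
    hg.integrable_mul (Lp.memLp (𝓕 h : L2 E))
  rw [h1]
  filter_upwards [coeFn_fourierInv (mulOp g hgt (𝓕 h)) (hint.congr h2.symm)] with X hX
  rw [hX, ← Lp.inner_fourier_eq, multiplierKernel, FourierTransform.fourier_fourierInv_eq,
    L2.inner_def, Real.fourierInv_eq]
  refine integral_congr_ae ?_
  filter_upwards [h2, (memLp_modulate hg X).coeFn_toLp] with ξ h3 h4
  rw [h3, h4, RCLike.inner_apply, modulate, Complex.conj_conj, Circle.smul_def, smul_eq_mul]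
  ring

theorem enorm_sq_eq_lintegral (f : L2 E) : ‖f‖ₑ ^ 2 = ∫⁻ x, ‖f x‖ₑ ^ 2 := by
  rw [Lp.enorm_def, eLpNorm_eq_lintegral_rpow_enorm_toReal two_ne_zero ENNReal.ofNat_ne_top]
  simp only [ENNReal.toReal_ofNat, ENNReal.rpow_ofNat]
  rw [← ENNReal.rpow_natCast, ← ENNReal.rpow_mul]
  norm_num

/-- The Hilbert–Schmidt bound for `t₁ g(p) t₂`. -/
theorem sum_enorm_sq_le {ι : Type*} [Fintype ι] {e : ι → L2 E} (he : Orthonormal ℂ e)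
    {t₁ : E → ℂ} {t₂ : E → ℝ} (ht₁ : MemLp t₁ ∞ volume)
    (ht₂ : MemLp (fun x => (t₂ x : ℂ)) ∞ volume) {g : E → ℂ} (hgt : MemLp g ∞ volume)
    (hg : MemLp g 2 volume) (hg1 : Integrable g) :
    ∑ i, ‖mulOp t₁ ht₁ (fourierMulOp g hgt (mulOp _ ht₂ (e i)))‖ₑ ^ 2 ≤
      ∫⁻ X, ‖t₁ X‖ₑ ^ 2 *
        ∫⁻ U, ‖t₂ U‖ₑ ^ 2 * ‖(𝓕⁻ (modulate g 0) : E → ℂ) (U - X)‖ₑ ^ 2 := by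
  have hmeas (f : L2 E) : AEMeasurable (fun x => ‖f x‖ₑ ^ 2) volume :=
    (Lp.aestronglyMeasurable f).enorm.pow_const 2
  simp_rw [enorm_sq_eq_lintegral]
  rw [← lintegral_finsetSum' _ fun i _ => hmeas _]
  refine lintegral_mono_ae ?_
  have h1 := fun i => coeFn_mulOp ht₁ (fourierMulOp g hgt (mulOp _ ht₂ (e i)))
  have h2 := fun i => coeFn_fourierMulOp hgt hg (mulOp _ ht₂ (e i))
  filter_upwards [ae_all_iff.mpr h1, ae_all_iff.mpr h2] with X h1 h2
  simp_rw [h1, h2, enorm_mul, mul_pow, ← Finset.mul_sum]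
  gcongr
  -- Bessel's inequality for t₂ times the kernel at the fixed point X.
  have h3 : ∑ i, ‖(inner ℂ (multiplierKernel hg X) (mulOp _ ht₂ (e i)) : ℂ)‖ₑ ^ 2 ≤
      ‖mulOp _ ht₂ (multiplierKernel hg X)‖ₑ ^ 2 := by
    simp_rw [← inner_mulOp_left ht₂, ← ofReal_norm, ← ENNReal.ofReal_pow (norm_nonneg _)]
    rw [← ENNReal.ofReal_sum_of_nonneg fun i _ => by positivity]
    refine ENNReal.ofReal_le_ofReal ?_
    simp_rw [norm_inner_symm _ (e _)]
    exact he.sum_inner_products_le _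
  refine h3.trans (le_of_eq ?_)
  rw [enorm_sq_eq_lintegral]
  refine lintegral_congr_ae ?_
  filter_upwards [coeFn_mulOp ht₂ (multiplierKernel hg X), coeFn_multiplierKernel hg hg1 X]
    with U h4 h5
  rw [h4, h5, enorm_mul, mul_pow]
  congr 2
  rw [← ofReal_norm, ← ofReal_norm, Complex.norm_real]

theorem lintegral_fourierInv_modulate_lt_top {g : E → ℂ} (hg : MemLp g 2 volume)
    (hg1 : Integrable g) : ∫⁻ U, ‖(𝓕⁻ (modulate g 0) : E → ℂ) U‖ₑ ^ 2 < ∞ := by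
  have h := enorm_sq_eq_lintegral (multiplierKernel hg (0 : E))
  have h2 : ∫⁻ U, ‖(𝓕⁻ (modulate g 0) : E → ℂ) U‖ₑ ^ 2 = ‖multiplierKernel hg (0 : E)‖ₑ ^ 2 := by
    rw [h]
    refine lintegral_congr_ae ?_
    filter_upwards [coeFn_multiplierKernel hg hg1 0] with U hU
    rw [hU, sub_zero]
  rw [h2]
  exact ENNReal.pow_lt_top enorm_lt_top

/-- The Hilbert–Schmidt bound for `t₁ g(p) t₂`, when the correlation of `|t₁|²` and `|t₂|²` is
bounded. -/
theorem exists_sum_norm_sq_le {t₁ : E → ℂ} {t₂ : E → ℝ} (ht₁ : MemLp t₁ ∞ volume)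
    (ht₂ : MemLp (fun x => (t₂ x : ℂ)) ∞ volume) (hm₁ : Measurable t₁) (hm₂ : Measurable t₂)
    {D : ℝ≥0∞} (hD : D < ∞) (hcorr : ∀ U, ∫⁻ X, ‖t₁ X‖ₑ ^ 2 * ‖t₂ (X + U)‖ₑ ^ 2 ≤ D)
    {g : E → ℂ} (hgt : MemLp g ∞ volume) (hg : MemLp g 2 volume) (hg1 : Integrable g) :
    ∃ Γ : ℝ, ∀ (n : ℕ) (e : Fin n → L2 E), Orthonormal ℂ e →
      ∑ i, ‖mulOp t₁ ht₁ (fourierMulOp g hgt (mulOp _ ht₂ (e i)))‖ ^ 2 ≤ Γ := by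
  set k : E → ℝ≥0∞ := fun U => ‖(𝓕⁻ (modulate g 0) : E → ℂ) U‖ₑ ^ 2 with hk
  have hint : Integrable (modulate g 0) :=
    memLp_one_iff_integrable.mp (memLp_modulate (memLp_one_iff_integrable.mpr hg1) 0)
  have hkm : Measurable k := (continuous_fourierInv hint).measurable.enorm.pow_const 2
  have hkfin : ∫⁻ U, k U < ∞ := lintegral_fourierInv_modulate_lt_top hg hg1
  -- Translating U by X and exchanging integrals isolates the correlation at displacement U, bounded
  -- by D, against the integrable |kernel|².
  have hbound : ∫⁻ X, ‖t₁ X‖ₑ ^ 2 * ∫⁻ U, ‖t₂ U‖ₑ ^ 2 * k (U - X) ≤ D * ∫⁻ U, k U := by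
    calc ∫⁻ X, ‖t₁ X‖ₑ ^ 2 * ∫⁻ U, ‖t₂ U‖ₑ ^ 2 * k (U - X)
        = ∫⁻ X, ∫⁻ U, ‖t₁ X‖ₑ ^ 2 * ‖t₂ (X + U)‖ₑ ^ 2 * k U := by
          refine lintegral_congr fun X => ?_
          rw [← lintegral_add_left_eq_self _ X,
            ← lintegral_const_mul _ (by fun_prop)]
          refine lintegral_congr fun U => ?_
          rw [add_sub_cancel_left, mul_assoc]
      _ = ∫⁻ U, ∫⁻ X, ‖t₁ X‖ₑ ^ 2 * ‖t₂ (X + U)‖ₑ ^ 2 * k U :=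
          lintegral_lintegral_swap (by unfold Function.uncurry; fun_prop)
      _ ≤ ∫⁻ U, D * k U := by
          refine lintegral_mono fun U => ?_
          rw [lintegral_mul_const _ (by fun_prop)]
          exact mul_le_mul_left (hcorr U) _
      _ = _ := lintegral_const_mul _ hkm
  refine ⟨(D * ∫⁻ U, k U).toReal, fun n e he => ?_⟩
  have h := (sum_enorm_sq_le he ht₁ ht₂ hgt hg hg1).trans hbound
  rw [← ENNReal.ofReal_le_iff_le_toReal (ENNReal.mul_lt_top hD hkfin).ne,
    ENNReal.ofReal_sum_of_nonneg fun i _ => by positivity]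
  refine le_trans (le_of_eq ?_) h
  refine Finset.sum_congr rfl fun i _ => ?_
  rw [ENNReal.ofReal_pow (norm_nonneg _), ofReal_norm]

end Kernel

/-! ### High-momentum cutoff of the resolvent -/

section Truncation

/-- The symbol of the resolvent, cut off outside of a ball. -/
noncomputable def truncatedSymbol (E : Type*) [NormedAddCommGroup E] (z r : ℝ) : E → ℂ :=
  (Metric.closedBall 0 r).indicator fun ξ => ((((2 * Real.pi * ‖ξ‖) ^ 2 + z ^ 2)⁻¹ : ℝ) : ℂ)

theorem norm_sub_truncatedSymbol_le {E : Type*} [NormedAddCommGroup E]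
    (z : ℝ) {r : ℝ} (hr : 0 < r) (ξ : E) :
    ‖((((2 * Real.pi * ‖ξ‖) ^ 2 + z ^ 2)⁻¹ : ℝ) : ℂ) - truncatedSymbol E z r ξ‖ ≤ (r ^ 2)⁻¹ := by
  by_cases h : ξ ∈ Metric.closedBall (0 : E) r
  · rw [truncatedSymbol, Set.indicator_of_mem h, sub_self, norm_zero]
    positivity
  · rw [truncatedSymbol, Set.indicator_of_notMem h, sub_zero, Complex.norm_real,
      Real.norm_eq_abs, abs_of_nonneg (by positivity)]
    have h1 : r < ‖ξ‖ := by simpa using h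
    gcongr
    have h2 : r ≤ 2 * Real.pi * ‖ξ‖ := by nlinarith [Real.pi_gt_three]
    nlinarith [sq_nonneg z]

variable {E : Type*} [NormedAddCommGroup E] [InnerProductSpace ℝ E] [FiniteDimensional ℝ E]
  [MeasurableSpace E] [BorelSpace E]

theorem norm_mulOp_sub_mulOp_le {g h : E → ℂ} (hg : MemLp g ∞ volume) (hh : MemLp h ∞ volume)
    {C : ℝ} (hC : ∀ x, ‖g x - h x‖ ≤ C) (f : L2 E) :
    ‖mulOp g hg f - mulOp h hh f‖ ≤ C * ‖f‖ := by
  refine Lp.norm_le_mul_norm_of_ae_le_mul ?_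
  filter_upwards [coeFn_mulOp hg f, coeFn_mulOp hh f,
    Lp.coeFn_sub (mulOp g hg f) (mulOp h hh f)] with x h1 h2 h3
  rw [h3, Pi.sub_apply, h1, h2, ← sub_mul, norm_mul]
  exact mul_le_mul_of_nonneg_right (hC x) (norm_nonneg _)

theorem norm_fourierMulOp_sub_fourierMulOp_le {g h : E → ℂ} (hg : MemLp g ∞ volume)
    (hh : MemLp h ∞ volume) {C : ℝ} (hC : ∀ x, ‖g x - h x‖ ≤ C) (f : L2 E) :
    ‖fourierMulOp g hg f - fourierMulOp h hh f‖ ≤ C * ‖f‖ := by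
  change ‖(Lp.fourierTransformₗᵢ E ℂ).symm (mulOp g hg (𝓕 f)) -
    (Lp.fourierTransformₗᵢ E ℂ).symm (mulOp h hh (𝓕 f))‖ ≤ _
  rw [← map_sub, LinearIsometryEquiv.norm_map, ← Lp.norm_fourier_eq f]
  exact norm_mulOp_sub_mulOp_le hg hh hC _

theorem memLp_truncatedSymbol {z : ℝ} (hz : 0 < z) (r : ℝ) (p : ℝ≥0∞) :
    MemLp (truncatedSymbol E z r) p volume := by
  rw [truncatedSymbol, memLp_indicator_iff_restrict Metric.isClosed_closedBall.measurableSet]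
  have : IsFiniteMeasure (volume.restrict (Metric.closedBall (0 : E) r)) :=
    ⟨by simpa using measure_closedBall_lt_top⟩
  refine MemLp.of_bound (by fun_prop) (z ^ 2)⁻¹ (.of_forall fun ξ => ?_)
  rw [Complex.norm_real, Real.norm_eq_abs, abs_of_nonneg (by positivity)]
  gcongr
  nlinarith [sq_nonneg (2 * Real.pi * ‖ξ‖)]

end Truncation

/-! ### Pair correlations and off-diagonal entries -/

section Correlation

theorem lintegral_config {F : Config → ℝ≥0∞} (hF : Measurable F) :
    ∫⁻ X, F X = ∫⁻ x : Plane, ∫⁻ y : Plane, F (WithLp.toLp 2 (x, y)) := by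
  rw [← (WithLp.volume_preserving_toLp Plane Plane).lintegral_comp hF, Measure.volume_eq_prod,
    lintegral_prod (fun p => F (WithLp.toLp 2 p))
      (hF.comp (WithLp.volume_preserving_toLp Plane Plane).measurable).aemeasurable]

theorem lintegral_smul_add {E : Type*} [NormedAddCommGroup E] [NormedSpace ℝ E]
    [FiniteDimensional ℝ E] [MeasurableSpace E] [BorelSpace E] (μ : Measure E)
    [μ.IsAddHaarMeasure] {F : E → ℝ≥0∞} (hF : Measurable F) {b : ℝ} (hb : b ≠ 0) (c : E) :
    ∫⁻ y, F (b • y + c) ∂μ = ENNReal.ofReal |(b ^ Module.finrank ℝ E)⁻¹| * ∫⁻ y, F y ∂μ := by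
  rw [← lintegral_map (f := fun y => F (y + c)) (g := fun y => b • y) (by fun_prop)
    (measurable_const_smul b), Measure.map_addHaar_smul μ hb, lintegral_smul_measure,
    lintegral_add_right_eq_self F c]
  rfl

theorem PairInteraction.lintegral_plane_lt_top (v : PairInteraction) :
    ∫⁻ x : Plane, ‖v ‖x‖‖ₑ < ∞ := by
  obtain ⟨a, ha, b, hb, h⟩ := v.decay
  -- The exponent 3 exceeds the dimension 2 of the plane; exponential decay beats this power.
  have hint : Integrable (fun x : Plane => (1 + ‖x‖) ^ (-3 : ℝ)) :=
    integrable_one_add_norm (by simp; norm_num)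
  obtain ⟨K, hK⟩ : ∃ K : ℝ, ∀ r, 0 ≤ r → (1 + r) ^ 3 * Real.exp (-b * r) ≤ K := by
    -- The constant comes from s³/3! ≤ exp s at s = b(1 + r).
    refine ⟨6 * Real.exp b / b ^ 3, fun r hr => ?_⟩
    have h1 := Real.pow_div_factorial_le_exp (b * (1 + r)) (by positivity) 3
    rw [show (((3 : ℕ).factorial : ℕ) : ℝ) = 6 by norm_num [Nat.factorial], mul_pow,
      div_le_iff₀ (by norm_num)] at h1
    rw [le_div_iff₀ (by positivity)]
    calc (1 + r) ^ 3 * Real.exp (-b * r) * b ^ 3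
        = (b ^ 3 * (1 + r) ^ 3) * Real.exp (-b * r) := by ring
      _ ≤ Real.exp (b * (1 + r)) * 6 * Real.exp (-b * r) := by gcongr
      _ = 6 * (Real.exp (b * (1 + r)) * Real.exp (-b * r)) := by ring
      _ = _ := by rw [← Real.exp_add]; ring_nf
  have hint2 : Integrable (fun x : Plane => v ‖x‖) := by
    refine (hint.const_mul (a * K)).mono'
      (v.measurable_toFun.comp measurable_norm).aestronglyMeasurable (.of_forall fun x => ?_)
    refine (h _ (norm_nonneg x)).trans ?_
    rw [mul_assoc, Real.rpow_neg (by positivity), ← div_eq_mul_inv]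
    gcongr
    rw [le_div_iff₀ (by positivity), mul_comm]
    exact_mod_cast hK _ (norm_nonneg x)
  exact hint2.2

theorem enorm_sqrt_abs_sq (t : ℝ) : ‖((Real.sqrt |t| : ℝ) : ℂ)‖ₑ ^ 2 = ‖t‖ₑ := by
  rw [← ofReal_norm, Complex.norm_real, ← ENNReal.ofReal_pow (norm_nonneg _),
    Real.norm_eq_abs, sq_abs, Real.sq_sqrt (abs_nonneg _), ← Real.norm_eq_abs, ofReal_norm]

theorem pairPotential_zero (v : PairInteraction) (X : Config) :
    pairPotential v 0 X = v ‖X.fst‖ := by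
  have : position X (0 + 1) - position X (0 + 2) = -X.fst := by
    simp only [position, LinearMap.coe_mk, AddHom.coe_mk, zero_add, Matrix.cons_val]
    module
  rw [pairPotential, this, norm_neg]

/-- The coefficient of y₁ is ±√3/2. Its being nonzero makes this separation and x₁ independent
coordinates on ℝ⁴. -/
theorem exists_pairPotential_eq (v : PairInteraction) {β : Fin 3} (hβ : β ≠ 0) :
    ∃ a b : ℝ, b ≠ 0 ∧ ∀ X, pairPotential v β X = v ‖b • X.snd + a • X.fst‖ := by
  have h3 : (1 / Real.sqrt 3) + (1 / (2 * Real.sqrt 3)) ≠ 0 := by positivity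
  obtain rfl | rfl : β = 1 ∨ β = 2 := by omega
  · refine ⟨1 / 2, -((1 / Real.sqrt 3) + (1 / (2 * Real.sqrt 3))), neg_ne_zero.mpr h3,
      fun X => ?_⟩
    have : position X (1 + 1) - position X (1 + 2) =
        (-((1 / Real.sqrt 3) + (1 / (2 * Real.sqrt 3)))) • X.snd + (1 / 2 : ℝ) • X.fst := by
      change position X 2 - position X 0 = _
      simp only [position, LinearMap.coe_mk, AddHom.coe_mk, Matrix.cons_val]
      module
    rw [pairPotential, this]
  · refine ⟨1 / 2, (1 / Real.sqrt 3) + (1 / (2 * Real.sqrt 3)), h3, fun X => ?_⟩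
    have : position X (2 + 1) - position X (2 + 2) =
        ((1 / Real.sqrt 3) + (1 / (2 * Real.sqrt 3))) • X.snd + (1 / 2 : ℝ) • X.fst := by
      change position X 0 - position X 1 = _
      simp only [position, LinearMap.coe_mk, AddHom.coe_mk, Matrix.cons_val]
      module
    rw [pairPotential, this]

/-- The correlation of two different pair potentials is bounded. -/
theorem exists_lintegral_pairPotential_le (v : PairInteraction) {β : Fin 3} (hβ : β ≠ 0) :
    ∃ D < ∞, ∀ U : Config, ∫⁻ X, ‖pairPotential v 0 X‖ₑ * ‖pairPotential v β (X + U)‖ₑ ≤ D := by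
  obtain ⟨a, b, hb, h⟩ := exists_pairPotential_eq v hβ
  have hw : Measurable fun x : Plane => ‖v ‖x‖‖ₑ :=
    (v.measurable_toFun.comp measurable_norm).enorm
  set J := ∫⁻ x : Plane, ‖v ‖x‖‖ₑ with hJ
  refine ⟨(ENNReal.ofReal |(b ^ Module.finrank ℝ Plane)⁻¹| * J) * J,
    ENNReal.mul_lt_top (ENNReal.mul_lt_top ENNReal.ofReal_lt_top v.lintegral_plane_lt_top)
      v.lintegral_plane_lt_top, fun U => le_of_eq ?_⟩
  rw [lintegral_config (F := fun X => ‖pairPotential v 0 X‖ₑ * ‖pairPotential v β (X + U)‖ₑ)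
    ((measurable_pairPotential v 0).enorm.mul
      ((measurable_pairPotential v β).comp (measurable_add_const U)).enorm)]
  calc ∫⁻ x : Plane, ∫⁻ y : Plane, ‖pairPotential v 0 (WithLp.toLp 2 (x, y))‖ₑ *
        ‖pairPotential v β (WithLp.toLp 2 (x, y) + U)‖ₑ
      = ∫⁻ x : Plane, ‖v ‖x‖‖ₑ * (ENNReal.ofReal |(b ^ Module.finrank ℝ Plane)⁻¹| * J) := by
        refine lintegral_congr fun x => ?_
        -- For fixed x, the affine substitution in y decouples the two factors, whatever the shift
        -- U; hence the bound is uniform in U.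
        rw [hJ, ← lintegral_smul_add volume hw hb (b • U.snd + a • (x + U.fst)),
          ← lintegral_const_mul' _ _ enorm_ne_top]
        refine lintegral_congr fun y => ?_
        rw [pairPotential_zero, h, WithLp.toLp_fst, WithLp.add_snd, WithLp.add_fst,
          WithLp.toLp_fst, WithLp.toLp_snd, smul_add b, add_assoc]
    _ = _ := by rw [lintegral_mul_const _ hw, mul_comm]

theorem exists_norm_sqrtPotentialOp_le (v : PairInteraction) :
    ∃ C > 0, (∀ r, 0 ≤ r → |v r| ≤ C) ∧
      ∀ α f, ‖sqrtPotentialOp v α f‖ ≤ Real.sqrt C * ‖f‖ := by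
  obtain ⟨C, hC⟩ := v.exists_bound
  have hC' : ∀ r, 0 ≤ r → |v r| ≤ max C 1 := fun r hr => (hC r hr).trans (le_max_left _ _)
  refine ⟨max C 1, by positivity, hC', fun α f => norm_mulOp_apply_le _ (fun X => ?_) f⟩
  rw [Complex.norm_real, Real.norm_eq_abs, abs_of_nonneg (Real.sqrt_nonneg _)]
  exact Real.sqrt_le_sqrt (hC' _ (norm_nonneg _))

/-- The entry `M_{αβ}(z)` with `α ≠ β` is, up to a small error, a Hilbert–Schmidt operator. -/
theorem exists_approx_birmanSchwingerEntry (v : PairInteraction) (z : ℝ) (hz : 0 < z) {β : Fin 3}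
    (hβ : β ≠ 0) {ε : ℝ} (hε : 0 < ε) :
    ∃ (C : L2 Config →L[ℂ] L2 Config) (Γ : ℝ),
      (∀ f, ‖birmanSchwingerEntry v z hz 0 β f - C f‖ ≤ ε * ‖f‖) ∧
      ∀ (n : ℕ) (e : Fin n → L2 Config), Orthonormal ℂ e → ∑ i, ‖C (e i)‖ ^ 2 ≤ Γ := by
  obtain ⟨K, hK, -, hT⟩ := exists_norm_sqrtPotentialOp_le v
  obtain ⟨D, hD, hcorr⟩ := exists_lintegral_pairPotential_le v hβ
  -- The cutoff error is √K · r⁻² · √K = ε. A cutoff is needed because in dimension 4 the full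
  -- symbol just fails to be square integrable.
  set r : ℝ := Real.sqrt (K / ε) with hr
  have hr0 : 0 < r := Real.sqrt_pos.mpr (by positivity)
  have hr2 : r ^ 2 = K / ε := Real.sq_sqrt (by positivity)
  have hm (p : ℝ≥0∞) := memLp_truncatedSymbol (E := Config) hz r p
  obtain ⟨Γ, hΓ⟩ := exists_sum_norm_sq_le (memLp_sqrt_pairPotential v 0)
    (memLp_sqrt_pairPotential v β)
    (Complex.measurable_ofReal.comp (measurable_pairPotential v 0).abs.sqrt)
    (measurable_pairPotential v β).abs.sqrt hD (fun U => by
      refine le_trans (le_of_eq (lintegral_congr fun X => ?_)) (hcorr U)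
      rw [enorm_sqrt_abs_sq, ← enorm_sqrt_abs_sq (pairPotential v β (X + U)),
        ← ofReal_norm (_ : ℂ), Complex.norm_real, ofReal_norm]) (hm ∞) (hm 2)
    (memLp_one_iff_integrable.mp (hm 1))
  refine ⟨sqrtPotentialOp v 0 ∘L fourierMulOp _ (hm ∞) ∘L sqrtPotentialOp v β, Γ,
    fun f => ?_, hΓ⟩
  have h1 := norm_fourierMulOp_sub_fourierMulOp_le (resolventSymbol_memLp z hz) (hm ∞)
    (norm_sub_truncatedSymbol_le z hr0) (sqrtPotentialOp v β f)
  change ‖sqrtPotentialOp v 0 (resolvent Config z hz (sqrtPotentialOp v β f)) -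
    sqrtPotentialOp v 0 (fourierMulOp _ (hm ∞) (sqrtPotentialOp v β f))‖ ≤ _
  rw [← map_sub, resolvent_eq_fourierMulOp]
  refine (hT 0 _).trans ?_
  calc _ ≤ Real.sqrt K * ((r ^ 2)⁻¹ * (Real.sqrt K * ‖f‖)) := by
        gcongr
        exact h1.trans (by gcongr; exact hT β f)
    _ = (Real.sqrt K * Real.sqrt K) * (r ^ 2)⁻¹ * ‖f‖ := by ring
    _ = ε * ‖f‖ := by
        rw [Real.mul_self_sqrt hK.le, hr2]
        field_simp

end Correlation

/-! ### Quadratic forms on Schwartz functions -/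

section Schwartz

variable {E : Type*} [NormedAddCommGroup E] [InnerProductSpace ℝ E] [FiniteDimensional ℝ E]
  [MeasurableSpace E] [BorelSpace E]

theorem toDistrib_toLp (f : 𝓢(E, ℂ)) :
    toDistrib E (f.toLp 2 volume) = f.toTemperedDistributionCLM E ℂ volume :=
  Lp.toTemperedDistribution_toLp_eq f

theorem toLp_mem_domain (f : 𝓢(E, ℂ)) : f.toLp 2 volume ∈ (negLaplacian E).domain := by
  change TemperedDistribution.MemSobolev 2 2 (toDistrib E (f.toLp 2 volume))
  rw [toDistrib_toLp]
  exact f.memSobolev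

theorem negLaplacian_toLp (f : 𝓢(E, ℂ)) :
    negLaplacian E ⟨f.toLp 2 volume, toLp_mem_domain f⟩ = (-Δ f).toLp 2 volume := by
  apply toDistrib_injective
  rw [toDistrib_negLaplacian, toDistrib_toLp, toDistrib_toLp,
    TemperedDistribution.laplacian_toTemperedDistributionCLM_eq, map_neg]

theorem resolvent_toLp (z : ℝ) (hz : 0 < z) (f : 𝓢(E, ℂ)) :
    resolvent E z hz (f.toLp 2 volume) = (SchwartzMap.fourierMultiplierCLM ℂ
      (fun ξ : E => ((((2 * Real.pi * ‖ξ‖) ^ 2 + z ^ 2)⁻¹ : ℝ) : ℂ)) f).toLp 2 volume := by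
  apply toDistrib_injective
  rw [toDistrib_resolvent, toDistrib_toLp, toDistrib_toLp,
    TemperedDistribution.fourierMultiplierCLM_toTemperedDistributionCLM_eq
      (hasTemperateGrowth_resolventSymbol z hz)]

/-- The energy density of a Schwartz function. -/
theorem coeFn_inner_toLp_add_mulOp {w : E → ℝ} (hw : MemLp (fun x => (w x : ℂ)) ∞ volume)
    (f g : 𝓢(E, ℂ)) :
    (fun x => (inner ℂ (f.toLp 2 volume x)
      ((g.toLp 2 volume + mulOp _ hw (f.toLp 2 volume) : L2 E) x)).re) =ᵐ[volume]
      fun x => (inner ℂ (f x) (g x)).re + w x * ‖f x‖ ^ 2 := by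
  filter_upwards [SchwartzMap.coeFn_toLp f 2 (volume : Measure E),
    SchwartzMap.coeFn_toLp g 2 (volume : Measure E), coeFn_mulOp hw (f.toLp 2 volume),
    Lp.coeFn_add (g.toLp 2 volume) (mulOp _ hw (f.toLp 2 volume))] with x h1 h2 h3 h4
  rw [h4, Pi.add_apply, h3, h1, h2, inner_add_right, Complex.add_re]
  congr 1
  rw [RCLike.inner_apply, mul_assoc, Complex.mul_conj, Complex.normSq_eq_norm_sq]
  norm_cast

theorem integrable_energy {w : E → ℝ} (hw : MemLp (fun x => (w x : ℂ)) ∞ volume)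
    (f g : 𝓢(E, ℂ)) :
    Integrable fun x => (inner ℂ (f x) (g x)).re + w x * ‖f x‖ ^ 2 :=
  (L2.integrable_inner (𝕜 := ℂ) (f.toLp 2 volume)
    (g.toLp 2 volume + mulOp _ hw (f.toLp 2 volume))).re.congr
    (coeFn_inner_toLp_add_mulOp hw f g)

theorem re_inner_toLp_add_mulOp {w : E → ℝ} (hw : MemLp (fun x => (w x : ℂ)) ∞ volume)
    (f g : 𝓢(E, ℂ)) :
    (inner ℂ (f.toLp 2 volume) (g.toLp 2 volume + mulOp _ hw (f.toLp 2 volume))).re =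
      ∫ x, (inner ℂ (f x) (g x)).re + w x * ‖f x‖ ^ 2 := by
  rw [← integral_congr_ae (coeFn_inner_toLp_add_mulOp hw f g), L2.inner_def]
  exact (integral_re (𝕜 := ℂ) (L2.integrable_inner _ _)).symm

theorem integrable_re_inner (f g : 𝓢(E, ℂ)) : Integrable fun x => (inner ℂ (f x) (g x)).re := by
  simpa using integrable_energy (w := fun _ => 0) (memLp_top_ofReal (C := 0) (by fun_prop)
    (by simp)) f g

theorem re_inner_toLp (f g : 𝓢(E, ℂ)) :
    (inner ℂ (f.toLp 2 volume) (g.toLp 2 volume)).re = ∫ x, (inner ℂ (f x) (g x)).re := by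
  rw [SchwartzMap.inner_toL2_toL2_eq f g volume]
  refine (integral_re (𝕜 := ℂ) ?_).symm
  refine (L2.integrable_inner (𝕜 := ℂ) (f.toLp 2 volume) (g.toLp 2 volume)).congr ?_
  filter_upwards [SchwartzMap.coeFn_toLp f 2 (volume : Measure E),
    SchwartzMap.coeFn_toLp g 2 (volume : Measure E)] with x h1 h2
  rw [h1, h2]

theorem integral_re_inner_neg_laplacian_nonneg (f : 𝓢(E, ℂ)) :
    0 ≤ ∫ x, (inner ℂ (f x) ((-Δ f) x)).re := by
  rw [← re_inner_toLp, ← negLaplacian_toLp]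
  exact re_inner_negLaplacian_nonneg ⟨f.toLp 2 volume, toLp_mem_domain f⟩

theorem integral_twoBody_nonneg {v : PairInteraction} (hv : IsNonneg (twoBodyHamiltonian v 1))
    (f : 𝓢(Plane, ℂ)) (hf : ∀ x, f (-x) = -f x) :
    0 ≤ ∫ x, (inner ℂ (f x) ((-Δ f) x)).re + v ‖x‖ * ‖f x‖ ^ 2 := by
  rw [← re_inner_toLp_add_mulOp v.memLp_plane, ← negLaplacian_toLp]
  have hodd : (f.toLp 2 volume) ∈ oddSubspace := by
    change compOp _ _ = _
    rw [compOp_toLp, ← SchwartzMap.toLpCLM_apply (𝕜 := ℂ), ← SchwartzMap.toLpCLM_apply (𝕜 := ℂ),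
      ← map_neg]
    congr 1
    ext x
    exact hf x
  have hmem := (mem_domain_schrodinger_iff (((1 : ℝ) : ℂ) • mulOp _ v.memLp_plane) _ _).mpr
    ⟨hodd, toLp_mem_domain f⟩
  have happly : twoBodyHamiltonian v 1 ⟨_, hmem⟩ = negLaplacian Plane ⟨_, toLp_mem_domain f⟩ +
      ((1 : ℝ) : ℂ) • mulOp _ v.memLp_plane (f.toLp 2 volume) := rfl
  have h := hv ⟨_, hmem⟩
  rwa [happly, Complex.ofReal_one, one_smul] at h

end Schwartz

/-! ### Slicing ℝ⁴ into planes -/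

section Slices

variable {D E : Type*} [NormedAddCommGroup D] [InnerProductSpace ℝ D] [NormedAddCommGroup E]
  [InnerProductSpace ℝ E]

/-- The restriction of a Schwartz function to an affine subspace. -/
noncomputable def affineSlice (L : D →ₗᵢ[ℝ] E) (c : E) : 𝓢(E, ℂ) →L[ℂ] 𝓢(D, ℂ) :=
  SchwartzMap.compCLMOfAntilipschitz ℂ (g := fun x => L x + c) (K := 1)
    (L.toContinuousLinearMap.hasTemperateGrowth.add (.const c))
    fun x y => by simp [L.isometry.edist_eq]

theorem affineSlice_apply (L : D →ₗᵢ[ℝ] E) (c : E) (f : 𝓢(E, ℂ)) (x : D) :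
    affineSlice L c f x = f (L x + c) := rfl

theorem lineDeriv_affineSlice (L : D →ₗᵢ[ℝ] E) (c : E) (f : 𝓢(E, ℂ)) (m : D) :
    LineDeriv.lineDerivOp m (affineSlice L c f) =
      affineSlice L c (LineDeriv.lineDerivOp (L m) f) := by
  ext x
  rw [affineSlice_apply, SchwartzMap.lineDerivOp_apply, SchwartzMap.lineDerivOp_apply, lineDeriv,
    lineDeriv]
  congr 1
  ext t
  rw [affineSlice_apply, L.map_add, L.map_smul, add_right_comm]

theorem laplacian_affineSlice [FiniteDimensional ℝ D] {ι : Type*} [Fintype ι]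
    (b : OrthonormalBasis ι ℝ D)
    (L : D →ₗᵢ[ℝ] E) (c : E) (f : 𝓢(E, ℂ)) :
    Δ (affineSlice L c f) = affineSlice L c
      (∑ i, LineDeriv.lineDerivOp (L (b i)) (LineDeriv.lineDerivOp (L (b i)) f)) := by
  rw [SchwartzMap.laplacian_eq_sum b, map_sum]
  simp_rw [lineDeriv_affineSlice]

/-- The embedding `x ↦ (x, 0)`. -/
noncomputable def inlIsometry : Plane →ₗᵢ[ℝ] Config where
  toLinearMap := (WithLp.linearEquiv 2 ℝ (Plane × Plane)).symm.toLinearMap ∘ₗ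
    LinearMap.inl ℝ Plane Plane
  norm_map' x := WithLp.norm_toLp_fst 2 Plane Plane x

/-- The embedding `y ↦ (0, y)`. -/
noncomputable def inrIsometry : Plane →ₗᵢ[ℝ] Config where
  toLinearMap := (WithLp.linearEquiv 2 ℝ (Plane × Plane)).symm.toLinearMap ∘ₗ
    LinearMap.inr ℝ Plane Plane
  norm_map' x := WithLp.norm_toLp_snd 2 Plane Plane x

theorem inlIsometry_add_inrIsometry (x y : Plane) :
    inlIsometry x + inrIsometry y = WithLp.toLp 2 (x, y) := by
  change WithLp.toLp 2 (x, 0) + WithLp.toLp 2 (0, y) = _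
  rw [← WithLp.toLp_add, Prod.mk_add_mk, add_zero, zero_add]

theorem integrable_config_prod {F : Config → ℝ} (hF : Integrable F) :
    Integrable (fun p : Plane × Plane => F (WithLp.toLp 2 p)) (volume.prod volume) :=
  (WithLp.volume_preserving_toLp Plane Plane).integrable_comp_of_integrable hF

theorem integral_config (F : Config → ℝ) :
    ∫ X, F X = ∫ p : Plane × Plane, F (WithLp.toLp 2 p) ∂(volume.prod volume) :=
  ((WithLp.volume_preserving_toLp Plane Plane).integral_comp
    (MeasurableEquiv.toLp 2 (Plane × Plane)).measurableEmbedding F).symm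

/-- The two-body inequality for the coordinate `x`, and `-Δ_y ≥ 0`. -/
theorem integral_threeBody_nonneg {v : PairInteraction} (hv : IsNonneg (twoBodyHamiltonian v 1))
    (f : 𝓢(Config, ℂ)) (hf : ∀ x y : Plane, f (WithLp.toLp 2 (-x, y)) = -f (WithLp.toLp 2 (x, y))) :
    0 ≤ ∫ X, (inner ℂ (f X) ((-Δ f) X)).re + pairPotential v 0 X * ‖f X‖ ^ 2 := by
  set b := stdOrthonormalBasis ℝ Plane
  set g₁ : 𝓢(Config, ℂ) := ∑ i, LineDeriv.lineDerivOp (inlIsometry (b i))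
    (LineDeriv.lineDerivOp (inlIsometry (b i)) f) with hg₁
  set g₂ : 𝓢(Config, ℂ) := ∑ i, LineDeriv.lineDerivOp (inrIsometry (b i))
    (LineDeriv.lineDerivOp (inrIsometry (b i)) f) with hg₂
  have hsum : Δ f = g₁ + g₂ := by
    rw [SchwartzMap.laplacian_eq_sum (b.prod b), Fintype.sum_sum_type]
    simp only [OrthonormalBasis.prod_apply, Sum.elim_inl, Sum.elim_inr]
    rfl
  have hi₁ := integrable_energy (memLp_pairPotential v 0) f (-g₁)
  have hi₂ := integrable_re_inner f (-g₂)
  have hsplit : (fun X => (inner ℂ (f X) ((-Δ f) X)).re + pairPotential v 0 X * ‖f X‖ ^ 2) =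
      fun X => ((inner ℂ (f X) ((-g₁) X)).re + pairPotential v 0 X * ‖f X‖ ^ 2) +
        (inner ℂ (f X) ((-g₂) X)).re := by
    ext X
    rw [hsum, neg_add, add_apply, inner_add_right, Complex.add_re]
    ring
  rw [hsplit, integral_add hi₁ hi₂]
  refine add_nonneg ?_ ?_
  -- For each fixed y the slice in x is odd, so h(1) ≥ 0 applies to it, and Fubini integrates the
  -- result. The other term is -Δ_y ≥ 0 on slices in y.
  · rw [integral_config, integral_prod_symm _ (integrable_config_prod hi₁)]
    refine integral_nonneg fun y => ?_
    change (0 : ℝ) ≤ _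
    have h := integral_twoBody_nonneg hv (affineSlice inlIsometry (inrIsometry y) f) fun x => by
      rw [affineSlice_apply, affineSlice_apply, inlIsometry_add_inrIsometry,
        inlIsometry_add_inrIsometry, hf]
    rw [laplacian_affineSlice b, ← hg₁, ← map_neg] at h
    simpa only [affineSlice_apply, inlIsometry_add_inrIsometry, pairPotential_zero,
      WithLp.toLp_fst] using h
  · rw [integral_config, integral_prod _ (integrable_config_prod hi₂)]
    refine integral_nonneg fun x => ?_
    change (0 : ℝ) ≤ _
    have h := integral_re_inner_neg_laplacian_nonneg (affineSlice inrIsometry (inlIsometry x) f)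
    rw [laplacian_affineSlice b, ← hg₂, ← map_neg] at h
    simpa only [affineSlice_apply, add_comm (inrIsometry _), inlIsometry_add_inrIsometry] using h

end Slices

/-! ### The diagonal entry stays below 1 -/

section DiagonalEntry

theorem permIsometry_swap_toLp (x y : Plane) :
    permIsometry (Equiv.swap 1 2) (WithLp.toLp 2 (x, y)) = WithLp.toLp 2 (-x, y) := by
  have h : position (WithLp.toLp 2 (x, y)) ∘ Equiv.swap (1 : Fin 3) 2 =
      position (WithLp.toLp 2 (-x, y)) := by
    ext1 i
    fin_cases i <;>
      simp [position, Equiv.swap_apply_def]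
  change jacobi (position (WithLp.toLp 2 (x, y)) ∘ Equiv.swap (1 : Fin 3) 2) = _
  rw [h, jacobi_position]

theorem norm_sqrtPotentialOp_sq (v : PairInteraction) (α : Fin 3) (f : L2 Config) :
    ‖sqrtPotentialOp v α f‖ ^ 2 = -(inner ℂ f (potentialOp v α f)).re := by
  rw [potentialOp_eq, inner_neg_right, ← inner_sqrtPotentialOp_left, Complex.neg_re, neg_neg,
    re_inner_self]

theorem norm_sqrtPotentialOp_toLp_sq_le {v : PairInteraction}
    (hv : IsNonneg (twoBodyHamiltonian v 1)) (u : 𝓢(Config, ℂ))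
    (hu : permOp (Equiv.swap 1 2) (u.toLp 2 volume) = -u.toLp 2 volume) :
    ‖sqrtPotentialOp v 0 (u.toLp 2 volume)‖ ^ 2 ≤
      (inner ℂ (u.toLp 2 volume)
        (negLaplacian Config ⟨u.toLp 2 volume, toLp_mem_domain u⟩)).re := by
  have hodd (x y : Plane) : u (WithLp.toLp 2 (-x, y)) = -u (WithLp.toLp 2 (x, y)) := by
    have h1 := compOp_toLp (permIsometry (Equiv.swap 1 2)) u
    change permOp _ _ = _ at h1
    rw [hu, ← SchwartzMap.toLpCLM_apply (𝕜 := ℂ), ← map_neg, SchwartzMap.toLpCLM_apply] at h1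
    have h2 := DFunLike.congr_fun (SchwartzMap.injective_toLp 2 volume h1) (WithLp.toLp 2 (x, y))
    rw [← permIsometry_swap_toLp]
    exact h2.symm
  have h := integral_threeBody_nonneg hv u hodd
  rw [← re_inner_toLp_add_mulOp (memLp_pairPotential v 0), ← negLaplacian_toLp, inner_add_right,
    Complex.add_re] at h
  change 0 ≤ _ + (inner ℂ _ (potentialOp v 0 _)).re at h
  rw [norm_sqrtPotentialOp_sq]
  linarith

theorem negLaplacian_of_resolvent_eq {z : ℝ} {hz : 0 < z} {η ψ : L2 Config}
    (h : resolvent Config z hz η = ψ) (hψ : ψ ∈ (negLaplacian Config).domain) :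
    negLaplacian Config ⟨ψ, hψ⟩ = η - (z : ℂ) ^ 2 • ψ := by
  subst h
  exact negLaplacian_resolvent z hz η hψ

/-- The resolvent preserves Schwartz functions and the exchange symmetry, so the form inequality
applies to it; H₀ is then eliminated using H₀ = (H₀ + z²) - z². -/
theorem norm_sqrtPotentialOp_resolvent_toLp_sq_le {v : PairInteraction}
    (hv : IsNonneg (twoBodyHamiltonian v 1)) (z : ℝ) (hz : 0 < z) (s : 𝓢(Config, ℂ))
    (hs : permOp (Equiv.swap 1 2) (s.toLp 2 volume) = -s.toLp 2 volume) :
    ‖sqrtPotentialOp v 0 (resolvent Config z hz (s.toLp 2 volume))‖ ^ 2 ≤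
      (inner ℂ (resolvent Config z hz (s.toLp 2 volume)) (s.toLp 2 volume)).re -
        z ^ 2 * ‖resolvent Config z hz (s.toLp 2 volume)‖ ^ 2 := by
  obtain ⟨u, hu⟩ : ∃ u : 𝓢(Config, ℂ), resolvent Config z hz (s.toLp 2 volume) =
      u.toLp 2 volume := ⟨_, resolvent_toLp z hz s⟩
  have h1 := norm_sqrtPotentialOp_toLp_sq_le hv u (by rw [← hu, permOp_resolvent, hs, map_neg])
  rw [negLaplacian_of_resolvent_eq hu (toLp_mem_domain u), inner_sub_right, Complex.sub_re,
    inner_smul_right, ← Complex.ofReal_pow, Complex.re_ofReal_mul, re_inner_self] at h1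
  rwa [hu]

/-- Stated through the resolvent, both sides are continuous in η for the L² norm, so density of
Schwartz functions suffices. -/
theorem norm_sqrtPotentialOp_resolvent_sq_le {v : PairInteraction}
    (hv : IsNonneg (twoBodyHamiltonian v 1)) (z : ℝ) (hz : 0 < z) {η : L2 Config}
    (hη : permOp (Equiv.swap 1 2) η = -η) :
    ‖sqrtPotentialOp v 0 (resolvent Config z hz η)‖ ^ 2 ≤
      (inner ℂ (resolvent Config z hz η) η).re - z ^ 2 * ‖resolvent Config z hz η‖ ^ 2 := by
  -- Antisymmetrization Q keeps the approximants Schwartz and odd, and Q(η/2) = η for odd η.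
  set Q : L2 Config → L2 Config := fun s => s - permOp (Equiv.swap 1 2) s with hQ
  have hQc : Continuous Q := continuous_id.sub (permOp _).continuous
  have key (s : L2 Config) : ‖sqrtPotentialOp v 0 (resolvent Config z hz (Q s))‖ ^ 2 ≤
      (inner ℂ (resolvent Config z hz (Q s)) (Q s)).re -
        z ^ 2 * ‖resolvent Config z hz (Q s)‖ ^ 2 := by
    refine DenseRange.induction_on (p := fun s : L2 Config =>
      ‖sqrtPotentialOp v 0 (resolvent Config z hz (Q s))‖ ^ 2 ≤
        (inner ℂ (resolvent Config z hz (Q s)) (Q s)).re -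
          z ^ 2 * ‖resolvent Config z hz (Q s)‖ ^ 2)
      (SchwartzMap.denseRange_toLpCLM (p := 2) ENNReal.ofNat_ne_top) s ?_ fun s => ?_
    · have h1 := (resolvent Config z hz).continuous.comp hQc
      exact isClosed_le (((sqrtPotentialOp v 0).continuous.comp h1).norm.pow 2)
        ((Complex.continuous_re.comp (h1.inner hQc)).sub (continuous_const.mul (h1.norm.pow 2)))
    · have hs : Q (s.toLp 2 volume) = (s - SchwartzMap.compCLMOfContinuousLinearEquiv ℂ
          (permIsometry (Equiv.swap 1 2)).toContinuousLinearEquiv s).toLp 2 volume := by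
        have h1 : permOp (Equiv.swap 1 2) (s.toLp 2 volume) = _ := compOp_toLp _ s
        change s.toLp 2 volume - permOp (Equiv.swap 1 2) (s.toLp 2 volume) = _
        rw [h1]
        exact (map_sub (SchwartzMap.toLpCLM ℂ ℂ 2 (volume : Measure Config)) _ _).symm
      rw [SchwartzMap.toLpCLM_apply, hs]
      refine norm_sqrtPotentialOp_resolvent_toLp_sq_le hv z hz _ ?_
      rw [← hs]
      change permOp _ (_ - permOp _ _) = -(_ - permOp _ _)
      rw [map_sub, permOp_permOp, Equiv.swap_mul_self, permOp_one, neg_sub]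
  have h : Q ((1 / 2 : ℂ) • η) = η := by
    rw [hQ]
    change (1 / 2 : ℂ) • η - permOp _ ((1 / 2 : ℂ) • η) = η
    rw [map_smul, hη, smul_neg, sub_neg_eq_add, ← add_smul, add_halves, one_smul]
  have h2 := key ((1 / 2 : ℂ) • η)
  rwa [h] at h2

/-- The quadratic form of the diagonal entry `M₁₁(z)` is bounded by a constant smaller than `1` on
the functions that are odd with respect to the exchange of the particles `2` and `3`. -/
theorem exists_re_inner_birmanSchwingerEntry_zero_le {v : PairInteraction}
    (hv : IsNonneg (twoBodyHamiltonian v 1)) (z : ℝ) (hz : 0 < z) :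
    ∃ d < 1, ∀ f : L2 Config, permOp (Equiv.swap 1 2) f = -f →
      (inner ℂ f (birmanSchwingerEntry v z hz 0 0 f)).re ≤ d * ‖f‖ ^ 2 := by
  obtain ⟨K, hK, -, hT⟩ := exists_norm_sqrtPotentialOp_le v
  -- Since ‖|v₁|^{1/2} g‖² ≤ K‖g‖², the term z²‖g‖² improves the inequality by the factor 1 + z²/K;
  -- this is the margin.
  set c : ℝ := 1 + z ^ 2 / K with hc
  have hc1 : 1 < c := by
    have : 0 < z ^ 2 / K := by positivity
    linarith
  refine ⟨c⁻¹, inv_lt_one_of_one_lt₀ hc1, fun f hf => ?_⟩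
  have hη : permOp (Equiv.swap 1 2) (sqrtPotentialOp v 0 f) = -sqrtPotentialOp v 0 f := by
    rw [permOp_sqrtPotentialOp, hf, map_neg]
    rfl
  have h1 := norm_sqrtPotentialOp_resolvent_sq_le hv z hz hη
  set g := resolvent Config z hz (sqrtPotentialOp v 0 f) with hg
  change (inner ℂ f (sqrtPotentialOp v 0 g)).re ≤ _
  rw [re_inner_comm, inner_sqrtPotentialOp_left] at h1
  have h2 : ‖sqrtPotentialOp v 0 g‖ ^ 2 ≤ K * ‖g‖ ^ 2 := by
    have := pow_le_pow_left₀ (norm_nonneg _) (hT 0 g) 2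
    rwa [mul_pow, Real.sq_sqrt hK.le] at this
  have h3 : (inner ℂ f (sqrtPotentialOp v 0 g)).re ≤ ‖f‖ * ‖sqrtPotentialOp v 0 g‖ :=
    re_inner_le_norm (𝕜 := ℂ) f _
  set a := ‖sqrtPotentialOp v 0 g‖ with ha
  set t := (inner ℂ f (sqrtPotentialOp v 0 g)).re with ht
  have ha0 : 0 ≤ a := norm_nonneg _
  have h4 : c * a ^ 2 ≤ t := by
    have : z ^ 2 / K * a ^ 2 ≤ z ^ 2 * ‖g‖ ^ 2 := by
      rw [div_mul_eq_mul_div, div_le_iff₀ hK]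
      nlinarith [sq_nonneg z]
    rw [hc]
    linarith
  -- Combine ca² ≤ t and t ≤ ‖f‖a by completing the square.
  have h5 : c * t ≤ ‖f‖ ^ 2 := by
    nlinarith [sq_nonneg (c * a - ‖f‖)]
  rw [inv_mul_eq_div, le_div_iff₀ (by linarith)]
  linarith

end DiagonalEntry

/-! ### Finiteness above 1 -/

section Finiteness

/-- The unitary exchange of α and β maps one component to minus the other, so a single component
carries a third of the inner product. -/
theorem inner_apply_eq_of_mem_faddeevSpace {φ ψ : TripleL2} (hφ : φ ∈ faddeevSpace)
    (hψ : ψ ∈ faddeevSpace) (α β : Fin 3) :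
    inner ℂ (φ α) (ψ α) = (inner ℂ (φ β) (ψ β) : ℂ) := by
  rcases eq_or_ne α β with rfl | h
  · rfl
  · have h1 := (permOp (Equiv.swap α β)).inner_map_map (φ α) (ψ α)
    rw [hφ α β h, hψ α β h, Equiv.swap_apply_left, inner_neg_neg] at h1
    exact h1.symm

theorem inner_of_mem_faddeevSpace {φ ψ : TripleL2} (hφ : φ ∈ faddeevSpace)
    (hψ : ψ ∈ faddeevSpace) (α : Fin 3) : inner ℂ φ ψ = ((3 : ℝ) : ℂ) * inner ℂ (φ α) (ψ α) := by
  rw [PiLp.inner_apply, Finset.sum_congr rfl fun β _ =>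
    inner_apply_eq_of_mem_faddeevSpace hφ hψ β α]
  simp

theorem birmanSchwingerMatrix_apply_zero (v : PairInteraction) (z : ℝ) (hz : 0 < z)
    (φ : TripleL2) : birmanSchwingerMatrix v z hz φ 0 =
      birmanSchwingerEntry v z hz 0 0 (φ 0) + birmanSchwingerEntry v z hz 0 1 (φ 1) +
        birmanSchwingerEntry v z hz 0 2 (φ 2) := by
  rw [birmanSchwingerMatrix_apply, sqrtPotentialVec_apply, sqrtPotentialSum_apply,
    Fin.sum_univ_three, map_add, map_add, map_add, map_add]
  rfl

theorem re_inner_birmanSchwingerMatrix_sub_one_of_mem (v : PairInteraction) (z : ℝ) (hz : 0 < z)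
    {φ : TripleL2} (hφ : φ ∈ faddeevSpace) :
    (inner ℂ φ ((birmanSchwingerMatrix v z hz - 1) φ)).re =
      3 * ((inner ℂ (φ 0) (birmanSchwingerEntry v z hz 0 0 (φ 0))).re +
        (inner ℂ (φ 0) (birmanSchwingerEntry v z hz 0 1 (φ 1))).re +
        (inner ℂ (φ 0) (birmanSchwingerEntry v z hz 0 2 (φ 2))).re - ‖φ 0‖ ^ 2) := by
  rw [re_inner_birmanSchwingerMatrix_sub_one, ← re_inner_self, ← re_inner_self,
    inner_of_mem_faddeevSpace hφ hφ 0,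
    inner_of_mem_faddeevSpace hφ (birmanSchwingerMatrix_mem_faddeevSpace v z hz hφ) 0,
    birmanSchwingerMatrix_apply_zero, Complex.re_ofReal_mul, Complex.re_ofReal_mul,
    inner_add_right, inner_add_right, Complex.add_re, Complex.add_re]
  ring

theorem sq_le_two_mul_of_le_add {s a b : ℝ} (hs : 0 ≤ s) (h : s ≤ a + b) :
    s ^ 2 ≤ 2 * (a ^ 2 + b ^ 2) := by
  nlinarith [sq_nonneg (a - b)]

/-- The dimension of the subspaces of `𝓗_A` on which `M(z) > 1` is bounded. -/
theorem exists_finrank_le_of_isPosOn {v : PairInteraction}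
    (hv : IsNonneg (twoBodyHamiltonian v 1)) (z : ℝ) (hz : 0 < z) :
    ∃ N : ℕ, ∀ W ≤ faddeevSpace, FiniteDimensional ℂ W →
      IsPosOn (birmanSchwingerMatrix v z hz - 1) W → Module.finrank ℂ W ≤ N := by
  obtain ⟨d, hd, hdiag⟩ := exists_re_inner_birmanSchwingerEntry_zero_le hv z hz
  -- Each of the two off-diagonal entries costs (1 - d)/4, which leaves s = (1 - d)/2 for the
  -- Hilbert–Schmidt parts.
  have hε : 0 < (1 - d) / 4 := by linarith
  obtain ⟨C₁, Γ₁, hC₁, hΓ₁⟩ := exists_approx_birmanSchwingerEntry v z hz (β := 1) (by decide) hε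
  obtain ⟨C₂, Γ₂, hC₂, hΓ₂⟩ := exists_approx_birmanSchwingerEntry v z hz (β := 2) (by decide) hε
  set s := (1 - d) / 2 with hs
  have hs0 : 0 < s := by linarith
  refine ⟨⌊2 * (Γ₁ + Γ₂) / s ^ 2⌋₊, fun W hWF hfin hW => Nat.le_floor ?_⟩
  set b := stdOrthonormalBasis ℂ W
  -- The factor √3 makes every component family i ↦ e i β orthonormal.
  set e : Fin (Module.finrank ℂ W) → TripleL2 := fun i => ((Real.sqrt 3 : ℝ) : ℂ) • (b i : TripleL2)
    with he
  have heW (i) : e i ∈ W := W.smul_mem _ (b i).2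
  have hinner (i j) (β : Fin 3) : (inner ℂ (e i β) (e j β) : ℂ) = if i = j then 1 else 0 := by
    have h1 := inner_of_mem_faddeevSpace (hWF (b i).2) (hWF (b j).2) β
    have h2 := orthonormal_iff_ite.mp b.orthonormal i j
    rw [Submodule.coe_inner, h1] at h2
    rw [← h2, he]
    simp only [PiLp.smul_apply, inner_smul_left, inner_smul_right, Complex.conj_ofReal]
    rw [← mul_assoc, ← Complex.ofReal_mul, Real.mul_self_sqrt (by norm_num)]
  have horth (β : Fin 3) : Orthonormal ℂ fun i => e i β :=
    orthonormal_iff_ite.mpr fun i j => hinner i j β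
  have hnorm (i) (β : Fin 3) : ‖e i β‖ = 1 := (horth β).1 i
  -- Positivity of M - 1 at e i reads 1 < d + off-diagonal terms, whence s ≤ ‖C₁ (e i 1)‖ + ‖C₂ (e i
  -- 2)‖. Summing squares over i bounds the dimension by 2(Γ₁ + Γ₂)/s².
  have hlow (i) : s ^ 2 ≤ 2 * (‖C₁ (e i 1)‖ ^ 2 + ‖C₂ (e i 2)‖ ^ 2) := by
    have hne : e i ≠ 0 := fun h => by
      have := hnorm i 0
      rw [h] at this
      simp at this
    have h1 := hW (e i) (heW i) hne
    have hF := hWF (heW i)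
    have hσ : permOp (Equiv.swap 1 2) (e i 0) = -e i 0 := hF 1 2 (by decide) 0
    rw [re_inner_birmanSchwingerMatrix_sub_one_of_mem v z hz hF, hnorm] at h1
    have h2 := hdiag _ hσ
    have hoff {A C : L2 Config →L[ℂ] L2 Config} (hC : ∀ f, ‖A f - C f‖ ≤ (1 - d) / 4 * ‖f‖)
        (β : Fin 3) : (inner ℂ (e i 0) (A (e i β))).re ≤ ‖C (e i β)‖ + (1 - d) / 4 := by
      have h3 : (inner ℂ (e i 0) (A (e i β))).re ≤ ‖e i 0‖ * ‖A (e i β)‖ :=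
        re_inner_le_norm (𝕜 := ℂ) _ _
      have h4 := norm_le_norm_add_norm_sub (C (e i β)) (A (e i β))
      have h5 := hC (e i β)
      rw [hnorm, one_mul] at h3
      rw [norm_sub_rev, hnorm, mul_one] at h5
      linarith
    have h3 := hoff hC₁ 1
    have h4 := hoff hC₂ 2
    rw [hnorm] at h2
    refine sq_le_two_mul_of_le_add hs0.le ?_
    linarith
  have hsum := Finset.sum_le_sum fun i (_ : i ∈ Finset.univ) => hlow i
  rw [Finset.sum_const, Finset.card_univ, Fintype.card_fin, ← Finset.mul_sum,
    Finset.sum_add_distrib, nsmul_eq_mul] at hsum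
  rw [le_div_iff₀ (by positivity)]
  have h1 := hΓ₁ _ _ (horth 1)
  have h2 := hΓ₂ _ _ (horth 2)
  linarith

end Finiteness

end ThreeFermions

theorem lemma1 (v : ThreeFermions.PairInteraction) (hv : v.IsTuned) (z : ℝ) (hz : 0 < z) :
    ThreeFermions.boundStateCount v z =
      ThreeFermions.eigenvalueCount (ThreeFermions.birmanSchwinger v z hz) (Set.Ioi 1) := by
  obtain ⟨N, hN⟩ := ThreeFermions.exists_finrank_le_of_isPosOn hv.1 z hz
  exact ThreeFermions.boundStateCount_eq_of_finite v z hz N hN
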